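/- Let $n\ge 1$ be an integer and $0<\alpha<n$. For a compact set $E\subset\mathbb{R}^n$ set $$\gamma_\alpha(E)=\sup|\langle T,1\rangle|,$$ where the supremum is taken over all real distributions $T$ on $\mathbb{R}^n$ supported on $E$ such that, for each $1\le i\le n$, the convolution $\frac{x_i}{|x|^{1+\alpha}}*T$ is a function in $L^\infty(\mathbb{R}^n)$ with $\left\|\frac{x_i}{|x|^{1+\alpha}}*T\right\|_\infty\le 1$. Here $\langle T,1\rangle$ means $\langle T,\varphi\rangle$ for any test function $\varphi\in C_c^\infty(\mathbb{R}^n)$ equal to $1$ in a neighbourhood of the support of $T$. Let $\{E_j\}_j$ be a decreasing sequence of compact subsets of $\mathbb{R}^n$ with intersection $E$. Then $\gamma_\alpha(E)$ and all the $\gamma_\alpha(E_j)$ are finite, and $$\gamma_\alpha(E)=\lim_{j\to\infty}\gamma_\alpha(E_j).$$ -/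

import Mathlib

noncomputable section

open scoped Distributions ENNReal ContDiff
open MeasureTheory Filter Topology Distribution

namespace RieszCapacity

/-- The real test functions `C_c^∞(ℝⁿ)`. -/
abbrev Test (n : ℕ) : Type :=
  TestFunction (⊤ : TopologicalSpace.Opens (EuclideanSpace ℝ (Fin n))) ℝ ⊤

/-- The real distributions on `ℝⁿ`. -/
abbrev Dist (n : ℕ) : Type :=
  Distribution (⊤ : TopologicalSpace.Opens (EuclideanSpace ℝ (Fin n))) ℝ ⊤

variable {n : ℕ}

/-- The `i`-th component `x_i / |x|^{1+α}` of the vector valued Riesz kernel. -/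
def rieszKernel (α : ℝ) (i : Fin n) (x : EuclideanSpace ℝ (Fin n)) : ℝ :=
  x i / ‖x‖ ^ (1 + α)

open Classical in
/-- The action `⟨T, g⟩` of a compactly supported distribution `T` on a smooth function `g` which
need not have compact support: it is `T ψ` for any test function `ψ` that equals `g` in a
neighbourhood of the support of `T`. See `pairing_eq` and `exists_test_eventuallyEq` below for
independence of the choice of `ψ` and its existence. -/
def pairing (T : Dist n) (g : EuclideanSpace ℝ (Fin n) → ℝ) : ℝ :=
  if h : ∃ ψ : Test n, ψ =ᶠ[𝓝ˢ (dsupport T)] g then T h.choose else 0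

/-- The function `y ↦ ∫ K_i(x - y) φ(x) dx`, i.e. `K̃_i * φ` with `K̃_i(x) = K_i(-x)`. -/
def reflectedPotential (α : ℝ) (i : Fin n) (φ : EuclideanSpace ℝ (Fin n) → ℝ)
    (y : EuclideanSpace ℝ (Fin n)) : ℝ :=
  ∫ x, rieszKernel α i (x - y) * φ x

/-- For a compactly supported distribution `T`, the distribution `x_i / |x|^{1+α} * T` is the
function `f`: one has `⟨K_i * T, φ⟩ = ⟨T, K̃_i * φ⟩ = ∫ f φ` for all test functions `φ`. -/
def IsRieszPotential (α : ℝ) (i : Fin n) (T : Dist n)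
    (f : EuclideanSpace ℝ (Fin n) → ℝ) : Prop :=
  ∀ φ : Test n, pairing T (reflectedPotential α i φ) = ∫ x, f x * φ x

/-- The distributions `T` admissible for `E`: supported on `E`, with each component of the
`α`-Riesz potential a function in the closed unit ball of `L^∞(ℝⁿ)`. -/
def IsAdmissible (α : ℝ) (E : Set (EuclideanSpace ℝ (Fin n))) (T : Dist n) : Prop :=
  dsupport T ⊆ E ∧
    ∀ i : Fin n, ∃ f : EuclideanSpace ℝ (Fin n) → ℝ,
      AEStronglyMeasurable f volume ∧ eLpNorm f ⊤ volume ≤ 1 ∧ IsRieszPotential α i T f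

/-- The capacity `γ_α(E) = sup |⟨T, 1⟩|` over the distributions `T` admissible for `E`, as an
element of `[0, ∞]`. It is meant for compact sets `E`. -/
def capacity (α : ℝ) (E : Set (EuclideanSpace ℝ (Fin n))) : ℝ≥0∞ :=
  ⨆ (T : Dist n) (_ : IsAdmissible α E T), ENNReal.ofReal |pairing T 1|

/-- A test function multiplied by a smooth function. -/
def smulTest (ρ : EuclideanSpace ℝ (Fin n) → ℝ) (hρ : ContDiff ℝ ∞ ρ) (u : Test n) : Test n where
  toFun x := ρ x * u x
  contDiff' := hρ.mul u.contDiff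
  hasCompactSupport' := u.hasCompactSupport.mul_left
  tsupport_subset' := by simp

/-- A distribution vanishes on the test functions supported off its support. -/
theorem isVanishingOn_compl_dsupport (T : Dist n) : IsVanishingOn T (dsupport T)ᶜ := by
  intro u hu
  set ι := {a : Set (EuclideanSpace ℝ (Fin n)) // IsVanishingOn T a ∧ IsOpen a}
  have hcov : tsupport u ⊆ ⋃ a : ι, (a : Set (EuclideanSpace ℝ (Fin n))) := by
    rw [dsupport_compl_eq, Set.sUnion_eq_iUnion] at hu
    exact hu
  obtain ⟨t, ht⟩ := u.hasCompactSupport.isCompact.elim_finite_subcover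
    (fun a : ι => (a : Set (EuclideanSpace ℝ (Fin n)))) (fun a => a.2.2) hcov
  obtain ⟨ρ, hρ⟩ := SmoothPartitionOfUnity.exists_isSubordinate
    (modelWithCornersSelf ℝ (EuclideanSpace ℝ (Fin n))) (isClosed_tsupport u)
    (fun a : t => ((a : ι) : Set (EuclideanSpace ℝ (Fin n)))) (fun a => a.1.2.2)
    (by simpa [Set.iUnion_subtype] using ht)
  have hsum : u = ∑ a : t, smulTest (ρ a) (ρ a).contMDiff.contDiff u := by
    ext x
    have h1 : (∑ a : t, smulTest (ρ a) (ρ a).contMDiff.contDiff u : Test n) x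
        = ∑ a : t, ρ a x * u x := by
      rw [FunLike.coe_sum, Finset.sum_apply]; rfl
    rw [h1, ← Finset.sum_mul]
    by_cases hx : x ∈ tsupport u
    · have := ρ.sum_eq_one hx
      rw [finsum_eq_sum_of_fintype] at this
      rw [this, one_mul]
    · rw [image_eq_zero_of_notMem_tsupport hx, mul_zero]
  rw [hsum, map_sum]
  refine Finset.sum_eq_zero fun a _ => a.1.2.1 _ ?_
  exact (tsupport_mul_subset_left (f := ρ a) (g := u)).trans (hρ a)

theorem apply_eq_of_eventuallyEq (T : Dist n) (ψ₁ ψ₂ : Test n)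
    (h : ψ₁ =ᶠ[𝓝ˢ (dsupport T)] ψ₂) : T ψ₁ = T ψ₂ := by
  rw [← sub_eq_zero, ← map_sub]
  refine isVanishingOn_compl_dsupport T _ fun x hx hxT => ?_
  refine notMem_tsupport_iff_eventuallyEq.2 ?_ hx
  filter_upwards [h.filter_mono (nhds_le_nhdsSet hxT)] with y hy
  simp [hy]

theorem pairing_eq (T : Dist n) (g : EuclideanSpace ℝ (Fin n) → ℝ) (ψ : Test n)
    (h : ψ =ᶠ[𝓝ˢ (dsupport T)] g) : pairing T g = T ψ := by
  have hex : ∃ ψ : Test n, ψ =ᶠ[𝓝ˢ (dsupport T)] g := ⟨ψ, h⟩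
  rw [pairing, dif_pos hex]
  exact apply_eq_of_eventuallyEq T _ _ (hex.choose_spec.trans h.symm)

theorem exists_test_eventuallyEq {K : Set (EuclideanSpace ℝ (Fin n))} (hK : IsCompact K)
    {g : EuclideanSpace ℝ (Fin n) → ℝ} (hg : ContDiff ℝ ∞ g) :
    ∃ ψ : Test n, ψ =ᶠ[𝓝ˢ K] g := by
  obtain ⟨L, hL, hKL⟩ := exists_compact_superset hK
  obtain ⟨f, hf1, hf0, -⟩ := exists_contMDiffMap_one_nhds_of_subset_interior
    (n := (⊤ : ℕ∞)) (modelWithCornersSelf ℝ (EuclideanSpace ℝ (Fin n))) hK.isClosed hKL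
  have hfc : HasCompactSupport f := HasCompactSupport.intro hL hf0
  refine ⟨⟨fun x => f x * g x, f.contMDiff.contDiff.mul hg, hfc.mul_right, by simp⟩, ?_⟩
  filter_upwards [hf1] with x hx
  change f x * g x = g x
  rw [hx, one_mul]

end RieszCapacity

end

noncomputable section

open scoped Distributions ENNReal ContDiff
open MeasureTheory Filter Topology Distribution Set

namespace RieszCapacity

variable {n : ℕ}

/-! One inequality of the two is monotonicity of the capacity. For the other, choose near-maximisers
`T j` for the sets `E j` and pass to a weak limit. What has to be shown is that distributions
admissible for a fixed compact set form a relatively compact family, and that admissibility survives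
in the limit.

Compactness comes from an inversion formula. With `K̃_i (x) = K_i (-x)`, every test function
satisfies `c φ = ∑ i, K̃_i * g_i`, where `c ≠ 0` and each `g_i` is bounded and integrable
(`sum_reflectedPotential_rieszInverse`). Since `K_i * T` lies in the unit ball of `L^∞`, this gives
`|c| |T φ| ≤ ∑ i, ‖g_i‖₁` for every admissible `T` (`abs_apply_le`), and the right side is dominated
by a continuous function of `φ` vanishing at `0`. Finiteness of the capacity follows on taking `φ =
1` near the set.

To find `g_i`, put `β = (n + 1 - α) / 2`. Up to a constant, `K_i` is the integral of `s ^ (β - 1)`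
times minus the `i`-th derivative of the heat kernel, so `K̃_i *` is a multiple of `∂_i (-Δ) ^
(-β)`, and `g_i` should be a multiple of `∂_i (-Δ) ^ (β - 1) φ`. This fractional power is written
without Fourier analysis as `∫ r ^ (-β) D_r dr`, where `D_r` is an `n`-th order difference in time
of the heat flow of `∂_i φ`: the difference gives convergence at `0`, the derivative gives decay at
infinity.

The potential of an admissible `T` is only tested on test functions, so `g_i` is truncated and
mollified first; the error is removed because `T` has finite order on compact sets
(`abs_apply_mollify_le`).

Limits are taken along an ultrafilter. They are distributions by the bound above, their support
shrinks to the intersection, and their potentials are weak limits in the unit ball of `L^∞`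
(`exists_tendsto_integral_mul_test`). Evaluation at `1` is evaluation at one fixed cutoff, so it
passes to the limit. -/

/-- The partial derivative of a test function. -/
def partialDeriv (i : Fin n) : Test n →L[ℝ] Test n :=
  TestFunction.lineDerivCLM ℝ (EuclideanSpace.single i (1 : ℝ))

/-- The Laplacian of a test function. -/
def laplace : Test n →L[ℝ] Test n := ∑ i, partialDeriv i ∘L partialDeriv i

theorem partialDeriv_apply (i : Fin n) (φ : Test n) (x : EuclideanSpace ℝ (Fin n)) :
    partialDeriv i φ x = fderiv ℝ φ x (EuclideanSpace.single i 1) := by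
  rw [partialDeriv, TestFunction.lineDerivCLM_apply_of_le (by simp)]
  exact ((φ.contDiff.differentiable (by simp)) x).lineDeriv_eq_fderiv

theorem laplace_apply (φ : Test n) (x : EuclideanSpace ℝ (Fin n)) :
    laplace φ x = ∑ i, partialDeriv i (partialDeriv i φ) x := by
  rw [laplace, FunLike.coe_sum, Finset.sum_apply, FunLike.coe_sum, Finset.sum_apply]
  rfl

theorem Test.differentiable (φ : Test n) : Differentiable ℝ φ := φ.contDiff.differentiable (by simp)

theorem Test.integrable (φ : Test n) : Integrable φ :=
  φ.continuous.integrable_of_hasCompactSupport φ.hasCompactSupport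

theorem Test.exists_bound (φ : Test n) : ∃ C, 0 ≤ C ∧ ∀ x, |φ x| ≤ C := by
  obtain ⟨C, hC⟩ := φ.hasCompactSupport.exists_bound_of_continuous φ.continuous
  exact ⟨C, (norm_nonneg _).trans (hC 0), hC⟩

/-! ### The heat kernel and the heat semigroup on test functions. -/

/-- The heat kernel on `ℝⁿ`. -/
def heatKernel (s : ℝ) (z : EuclideanSpace ℝ (Fin n)) : ℝ :=
  (4 * Real.pi * s) ^ (-(n : ℝ) / 2) * Real.exp (-‖z‖ ^ 2 / (4 * s))

/-- The heat semigroup. -/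
def heatFlow (s : ℝ) (h : EuclideanSpace ℝ (Fin n) → ℝ) (y : EuclideanSpace ℝ (Fin n)) : ℝ :=
  ∫ z, heatKernel s z * h (y + z)

/-- Minus the `i`-th partial derivative of the heat kernel. -/
def gradKernel (i : Fin n) (s : ℝ) (z : EuclideanSpace ℝ (Fin n)) : ℝ :=
  z i / (2 * s) * heatKernel s z

theorem measurable_heatKernel :
    Measurable fun p : ℝ × EuclideanSpace ℝ (Fin n) => heatKernel p.1 p.2 := by
  unfold heatKernel; fun_prop

theorem measurable_gradKernel (i : Fin n) :
    Measurable fun p : ℝ × EuclideanSpace ℝ (Fin n) => gradKernel i p.1 p.2 := by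
  unfold gradKernel
  have := measurable_heatKernel (n := n)
  fun_prop

theorem continuous_heatKernel (s : ℝ) : Continuous (heatKernel (n := n) s) := by
  unfold heatKernel; fun_prop

theorem continuous_gradKernel (i : Fin n) (s : ℝ) : Continuous (gradKernel i s) := by
  unfold gradKernel
  have := continuous_heatKernel (n := n) s
  fun_prop

theorem heatKernel_nonneg {s : ℝ} (hs : 0 < s) (z : EuclideanSpace ℝ (Fin n)) :
    0 ≤ heatKernel s z := by
  unfold heatKernel; positivity

theorem heatKernel_le {s : ℝ} (hs : 0 < s) (z : EuclideanSpace ℝ (Fin n)) :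
    heatKernel s z ≤ (4 * Real.pi * s) ^ (-(n : ℝ) / 2) := by
  unfold heatKernel
  apply mul_le_of_le_one_right (by positivity)
  rw [Real.exp_le_one_iff]
  have : 0 ≤ ‖z‖ ^ 2 / (4 * s) := by positivity
  rw [neg_div]; linarith

theorem integral_exp_neg_sq {b : ℝ} (hb : 0 < b) :
    ∫ z : EuclideanSpace ℝ (Fin n), Real.exp (-b * ‖z‖ ^ 2) = (Real.pi / b) ^ ((n : ℝ) / 2) := by
  rw [GaussianFourier.integral_rexp_neg_mul_sq_norm hb, finrank_euclideanSpace, Fintype.card_fin]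

theorem integrable_exp_neg_sq {b : ℝ} (hb : 0 < b) :
    Integrable fun z : EuclideanSpace ℝ (Fin n) => Real.exp (-b * ‖z‖ ^ 2) := by
  refine Integrable.of_integral_ne_zero ?_
  rw [integral_exp_neg_sq hb]
  positivity

theorem integrable_heatKernel {s : ℝ} (hs : 0 < s) : Integrable (heatKernel (n := n) s) := by
  have := (integrable_exp_neg_sq (n := n) (b := 1 / (4 * s)) (by positivity)).const_mul
    ((4 * Real.pi * s) ^ (-(n : ℝ) / 2))
  refine this.congr (ae_of_all _ fun z => ?_)
  simp only [heatKernel]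
  congr 2; ring

theorem integral_heatKernel {s : ℝ} (hs : 0 < s) :
    ∫ z : EuclideanSpace ℝ (Fin n), heatKernel s z = 1 := by
  have h1 : ∀ z : EuclideanSpace ℝ (Fin n), heatKernel s z
      = (4 * Real.pi * s) ^ (-(n : ℝ) / 2) * Real.exp (-(1 / (4 * s)) * ‖z‖ ^ 2) := by
    intro z; simp only [heatKernel]; congr 2; ring
  simp_rw [h1]
  rw [integral_const_mul, integral_exp_neg_sq (by positivity),
    show Real.pi / (1 / (4 * s)) = 4 * Real.pi * s by field_simp,
    ← Real.rpow_add (by positivity)]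
  ring_nf; simp

/-- Half of the Gaussian exponent absorbs the factor `|z i| / (2 * s)` at the price of `s ^ (-1/2)`;
the other half is the Gaussian at time `2 * s`, and `2 ^ (n/2)` is the ratio of the normalisations.
-/
theorem abs_gradKernel_le (i : Fin n) {s : ℝ} (hs : 0 < s) (z : EuclideanSpace ℝ (Fin n)) :
    |gradKernel i s z| ≤ (2 : ℝ) ^ ((n : ℝ) / 2) * s ^ (-(1 / 2) : ℝ) * heatKernel (2 * s) z := by
  have hexp : Real.exp (-‖z‖ ^ 2 / (4 * s))
      = Real.exp (-‖z‖ ^ 2 / (8 * s)) * Real.exp (-‖z‖ ^ 2 / (8 * s)) := by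
    rw [← Real.exp_add]; congr 1; field_simp; ring
  have hpow : (4 * Real.pi * (2 * s)) ^ (-(n : ℝ) / 2)
      = (2 : ℝ) ^ (-((n : ℝ) / 2)) * (4 * Real.pi * s) ^ (-(n : ℝ) / 2) := by
    rw [show 4 * Real.pi * (2 * s) = 2 * (4 * Real.pi * s) by ring,
      Real.mul_rpow (by norm_num) (by positivity), neg_div]
  have hs' : s ^ (-(1 / 2) : ℝ) = 1 / √s := by
    rw [Real.rpow_neg hs.le, Real.sqrt_eq_rpow, one_div]; simp
  have hsq : 0 < √s := Real.sqrt_pos.2 hs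
  have hss : s = √s ^ 2 := (Real.sq_sqrt hs.le).symm
  have key : |z i| / (2 * s) * Real.exp (-‖z‖ ^ 2 / (8 * s)) ≤ 1 / √s := by
    have h1 : |z i| ≤ ‖z‖ := by simpa using PiLp.norm_apply_le z i
    have h2 : 1 + ‖z‖ ^ 2 / (8 * s) ≤ Real.exp (‖z‖ ^ 2 / (8 * s)) := by
      linarith [Real.add_one_le_exp (‖z‖ ^ 2 / (8 * s))]
    rw [neg_div, Real.exp_neg, ← div_eq_mul_inv, div_le_iff₀ (Real.exp_pos _)]
    refine le_trans ?_ (mul_le_mul_of_nonneg_left h2 (by positivity))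
    refine (div_le_div_of_nonneg_right h1 (by positivity)).trans ?_
    rw [← sub_nonneg]
    -- Completing the square shows that the difference is nonnegative.
    have : 1 / √s * (1 + ‖z‖ ^ 2 / (8 * s)) - ‖z‖ / (2 * s)
        = ((‖z‖ - 2 * √s) ^ 2 + 4 * √s ^ 2) / (8 * √s ^ 3) := by
      rw [hss]; simp only [Real.sqrt_sq hsq.le]; field_simp; ring
    rw [this]; positivity
  rw [gradKernel, abs_mul, abs_div, abs_of_nonneg (heatKernel_nonneg hs z),
    abs_of_pos (show 0 < 2 * s by positivity), heatKernel, heatKernel, hpow, hs', hexp,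
    show 4 * (2 * s) = 8 * s by ring, Real.rpow_neg (by norm_num) ((n : ℝ) / 2)]
  have h2n : (0 : ℝ) < 2 ^ ((n : ℝ) / 2) := by positivity
  have hA : (0 : ℝ) ≤ (4 * Real.pi * s) ^ (-(n : ℝ) / 2) * Real.exp (-‖z‖ ^ 2 / (8 * s)) := by
    positivity
  calc _ = (|z i| / (2 * s) * Real.exp (-‖z‖ ^ 2 / (8 * s)))
        * ((4 * Real.pi * s) ^ (-(n : ℝ) / 2) * Real.exp (-‖z‖ ^ 2 / (8 * s))) := by ring
    _ ≤ _ := mul_le_mul_of_nonneg_right key hA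
    _ = _ := by field_simp

theorem integrable_gradKernel (i : Fin n) {s : ℝ} (hs : 0 < s) : Integrable (gradKernel i s) := by
  refine ((integrable_heatKernel (n := n) (s := 2 * s) (by positivity)).const_mul
    ((2 : ℝ) ^ ((n : ℝ) / 2) * s ^ (-(1 / 2) : ℝ))).mono'
    (continuous_gradKernel i s).aestronglyMeasurable (ae_of_all _ fun z => ?_)
  exact abs_gradKernel_le i hs z

/-- The semigroup property of the heat kernel. -/
theorem integral_heatKernel_mul_heatKernel {s r : ℝ} (hs : 0 < s) (hr : 0 < r)
    (x : EuclideanSpace ℝ (Fin n)) :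
    ∫ z, heatKernel s z * heatKernel r (x - z) = heatKernel (s + r) x := by
  set b := (s + r) / (4 * s * r) with hb
  have hb0 : 0 < b := by positivity
  have h1 : ∀ z : EuclideanSpace ℝ (Fin n), heatKernel s z * heatKernel r (x - z)
      = ((4 * Real.pi * s) ^ (-(n : ℝ) / 2) * (4 * Real.pi * r) ^ (-(n : ℝ) / 2)
        * Real.exp (-‖x‖ ^ 2 / (4 * (s + r))))
        * Real.exp (-b * ‖z - (s / (s + r)) • x‖ ^ 2) := by
    intro z
    simp only [heatKernel]
    have : Real.exp (-‖z‖ ^ 2 / (4 * s)) * Real.exp (-‖x - z‖ ^ 2 / (4 * r))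
        = Real.exp (-‖x‖ ^ 2 / (4 * (s + r))) * Real.exp (-b * ‖z - (s / (s + r)) • x‖ ^ 2) := by
      rw [← Real.exp_add, ← Real.exp_add]
      congr 1
      rw [norm_sub_sq_real, norm_sub_sq_real, norm_smul, inner_smul_right, real_inner_comm z x,
        Real.norm_of_nonneg (by positivity : 0 ≤ s / (s + r)), hb]
      field_simp
      ring
    linear_combination ((4 * Real.pi * s) ^ (-(n : ℝ) / 2) * (4 * Real.pi * r) ^ (-(n : ℝ) / 2))
      * this
  simp_rw [h1]
  rw [integral_const_mul,
    integral_sub_right_eq_self (fun z : EuclideanSpace ℝ (Fin n) => Real.exp (-b * ‖z‖ ^ 2)),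
    integral_exp_neg_sq hb0, heatKernel]
  have h2 : (Real.pi / b) ^ ((n : ℝ) / 2)
      = ((4 * Real.pi * s) ^ (-(n : ℝ) / 2))⁻¹ * ((4 * Real.pi * r) ^ (-(n : ℝ) / 2))⁻¹
        * (4 * Real.pi * (s + r)) ^ (-(n : ℝ) / 2) := by
    rw [neg_div, ← Real.rpow_neg (by positivity), ← Real.rpow_neg (by positivity), neg_neg,
      Real.rpow_neg (by positivity), ← Real.inv_rpow (by positivity),
      ← Real.mul_rpow (by positivity) (by positivity),
      ← Real.mul_rpow (by positivity) (by positivity)]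
    congr 1
    rw [hb]; field_simp
  rw [h2]
  have : (4 * Real.pi * s) ^ (-(n : ℝ) / 2) ≠ 0 := by positivity
  have : (4 * Real.pi * r) ^ (-(n : ℝ) / 2) ≠ 0 := by positivity
  field_simp

theorem integrable_mul_test {k : EuclideanSpace ℝ (Fin n) → ℝ} (hk : Integrable k) (ψ : Test n)
    (y : EuclideanSpace ℝ (Fin n)) : Integrable fun z => k z * ψ (y + z) := by
  obtain ⟨C, -, hC⟩ := ψ.exists_bound
  exact hk.mul_bdd (c := C) (ψ.continuous.comp (by fun_prop)).aestronglyMeasurable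
    (ae_of_all _ fun z => hC _)

theorem measurable_heatFlow (ψ : Test n) :
    Measurable fun p : ℝ × EuclideanSpace ℝ (Fin n) => heatFlow p.1 ψ p.2 := by
  have h : StronglyMeasurable fun q : (ℝ × EuclideanSpace ℝ (Fin n)) × EuclideanSpace ℝ (Fin n) =>
      heatKernel q.1.1 q.2 * ψ (q.1.2 + q.2) := by
    have := measurable_heatKernel (n := n)
    have h2 := ψ.continuous.measurable
    exact Measurable.stronglyMeasurable (by fun_prop)
  exact h.integral_prod_right.measurable

theorem heatFlow_heatFlow {s r : ℝ} (hs : 0 < s) (hr : 0 < r) (ψ : Test n)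
    (y : EuclideanSpace ℝ (Fin n)) :
    heatFlow s (heatFlow r ψ) y = heatFlow (s + r) ψ y := by
  have h1 : ∀ z, heatFlow r ψ (y + z) = ∫ x, heatKernel r (x - z) * ψ (y + x) := by
    intro z
    rw [heatFlow, ← integral_sub_right_eq_self _ z]
    congr 1; ext x; rw [add_add_sub_cancel]
  simp only [heatFlow] at h1 ⊢
  simp_rw [h1, ← integral_const_mul]
  obtain ⟨C, hC0, hC⟩ := ψ.exists_bound
  have hint : Integrable (Function.uncurry fun z x : EuclideanSpace ℝ (Fin n) =>
      heatKernel s z * (heatKernel r (x - z) * ψ (y + x))) := by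
    have h2 : Integrable (fun p : EuclideanSpace ℝ (Fin n) × EuclideanSpace ℝ (Fin n) =>
        heatKernel s p.1 * heatKernel r (p.2 - p.1)) := by
      exact (measurePreserving_prod_sub (volume : Measure (EuclideanSpace ℝ (Fin n)))
        volume).integrable_comp_of_integrable
        ((integrable_heatKernel hs).mul_prod (integrable_heatKernel hr))
    have h3 := h2.mul_bdd (c := C) (g := fun p : EuclideanSpace ℝ (Fin n) × EuclideanSpace ℝ (Fin n) =>
      ψ (y + p.2)) (ψ.continuous.comp (by fun_prop)).aestronglyMeasurable
      (ae_of_all _ fun z => hC _)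
    refine h3.congr (ae_of_all _ fun p => ?_)
    simp [Function.uncurry, mul_assoc]
  rw [integral_integral_swap hint]
  congr 1; ext x
  rw [← integral_heatKernel_mul_heatKernel hs hr, ← integral_mul_const]
  congr 1; ext z; ring

theorem hasFDerivAt_heatKernel_apply (i : Fin n) {s : ℝ} (hs : 0 < s)
    (z : EuclideanSpace ℝ (Fin n)) :
    fderiv ℝ (heatKernel s) z (EuclideanSpace.single i 1) = -gradKernel i s z := by
  have h1 : HasFDerivAt (fun z : EuclideanSpace ℝ (Fin n) => -‖z‖ ^ 2 / (4 * s))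
      ((4 * s)⁻¹ • (-((2 : ℝ) • innerSL ℝ z))) z := by
    have := ((hasStrictFDerivAt_norm_sq z).hasFDerivAt.neg).const_mul (4 * s)⁻¹
    refine (this.congr_of_eventuallyEq (Eventually.of_forall fun w => ?_)).congr_fderiv ?_
    · simp; ring
    · simp [two_smul]
  have h2 := (h1.exp).const_mul ((4 * Real.pi * s) ^ (-(n : ℝ) / 2))
  have h3 : fderiv ℝ (heatKernel (n := n) s) z = _ := h2.fderiv
  rw [h3]
  simp [gradKernel, heatKernel, EuclideanSpace.inner_single_right]
  field_simp
  ring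

theorem differentiable_heatKernel (s : ℝ) : Differentiable ℝ (heatKernel (n := n) s) := by
  unfold heatKernel
  have h : Differentiable ℝ fun z : EuclideanSpace ℝ (Fin n) => ‖z‖ ^ 2 :=
    (contDiff_norm_sq ℝ (n := 1)).differentiable (by simp)
  fun_prop

/-- Integration by parts. -/
theorem heatFlow_partialDeriv (i : Fin n) {s : ℝ} (hs : 0 < s) (ψ : Test n)
    (y : EuclideanSpace ℝ (Fin n)) :
    heatFlow s (partialDeriv i ψ) y = ∫ z, gradKernel i s z * ψ (y + z) := by
  have hd : ∀ z, fderiv ℝ (fun z => ψ (y + z)) z (EuclideanSpace.single i 1)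
      = partialDeriv i ψ (y + z) := by
    intro z
    rw [partialDeriv_apply, fderiv_comp_add_left]
  have := integral_mul_fderiv_eq_neg_fderiv_mul_of_integrable (μ := volume)
    (f := heatKernel (n := n) s) (g := fun z => ψ (y + z)) (v := EuclideanSpace.single i (1 : ℝ))
    ?_ ?_ ?_ (fun x _ => differentiable_heatKernel s x)
    (fun x _ => ψ.differentiable.differentiableAt.comp x (by fun_prop))
  · simp_rw [hd, hasFDerivAt_heatKernel_apply i hs] at this
    rw [heatFlow, this, ← integral_neg]
    congr 1; ext z; ring
  · simp_rw [hasFDerivAt_heatKernel_apply i hs]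
    exact integrable_mul_test (integrable_gradKernel i hs).neg ψ y
  · simp_rw [hd]
    exact integrable_mul_test (integrable_heatKernel hs) _ y
  · exact integrable_mul_test (integrable_heatKernel hs) _ y

/-- Parabolic scaling moves the time from the kernel to the function, so that time derivatives and
the limit at time `0` fall on a smooth function under a fixed Gaussian weight. -/
theorem integral_comp_sqrt_smul {s : ℝ} (hs : 0 < s) (F : EuclideanSpace ℝ (Fin n) → ℝ) :
    ∫ z, heatKernel s z * F z = ∫ z, heatKernel 1 z * F (√s • z) := by
  have hsq : 0 < √s := Real.sqrt_pos.2 hs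
  have h1 : ∀ z : EuclideanSpace ℝ (Fin n),
      heatKernel 1 z * F (√s • z) = √s ^ n * (heatKernel s (√s • z) * F (√s • z)) := by
    intro z
    have : heatKernel 1 z = √s ^ n * heatKernel s (√s • z) := by
      simp only [heatKernel, mul_one]
      rw [Real.mul_rpow (by positivity) hs.le, norm_smul, Real.norm_of_nonneg hsq.le, mul_pow,
        Real.sq_sqrt hs.le]
      have h2 : √s ^ n * s ^ (-(n : ℝ) / 2) = 1 := by
        rw [← Real.rpow_natCast, Real.sqrt_eq_rpow, ← Real.rpow_mul hs.le, ← Real.rpow_add hs]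
        ring_nf; simp
      rw [show -(s * ‖z‖ ^ 2) / (4 * s) = -‖z‖ ^ 2 / 4 by field_simp]
      linear_combination -(4 * Real.pi) ^ (-(n : ℝ) / 2) * Real.exp (-‖z‖ ^ 2 / 4) * h2
    rw [this]; ring
  simp_rw [h1]
  rw [integral_const_mul,
    Measure.integral_comp_smul volume (fun z => heatKernel s z * F z) (√s)]
  simp only [finrank_euclideanSpace, Fintype.card_fin, smul_eq_mul]
  rw [abs_of_pos (by positivity)]
  field_simp

theorem integrable_norm_mul_heatKernel :
    Integrable fun z : EuclideanSpace ℝ (Fin n) => ‖z‖ * heatKernel 1 z := by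
  have h : ∀ z : EuclideanSpace ℝ (Fin n), ‖z‖ * heatKernel 1 z ≤ ∑ i, 2 * |gradKernel i 1 z| := by
    intro z
    have h1 : ‖z‖ ≤ ∑ i, |z i| := by
      have : z = ∑ i, z i • EuclideanSpace.single i (1 : ℝ) := by
        ext j; simp [Finset.sum_apply, Pi.single_apply]
      calc ‖z‖ = ‖∑ i, z i • EuclideanSpace.single i (1 : ℝ)‖ := by rw [← this]
        _ ≤ ∑ i, ‖z i • EuclideanSpace.single i (1 : ℝ)‖ := norm_sum_le _ _
        _ = _ := by simp [norm_smul]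
    calc _ ≤ (∑ i, |z i|) * heatKernel 1 z :=
          mul_le_mul_of_nonneg_right h1 (heatKernel_nonneg one_pos z)
      _ = _ := by
          rw [Finset.sum_mul]
          refine Finset.sum_congr rfl fun i _ => ?_
          rw [gradKernel, abs_mul, abs_of_nonneg (heatKernel_nonneg one_pos z), abs_div]
          simp; ring
  refine Integrable.mono' (integrable_finsetSum Finset.univ fun i _ =>
    ((integrable_gradKernel i one_pos).abs.const_mul 2))
    (continuous_norm.mul (continuous_heatKernel 1)).aestronglyMeasurable (ae_of_all _ fun z => ?_)
  rw [Real.norm_of_nonneg (mul_nonneg (norm_nonneg _) (heatKernel_nonneg one_pos z))]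
  exact h z

/-- The heat equation. -/
theorem hasDerivAt_heatFlow (ψ : Test n) (y : EuclideanSpace ℝ (Fin n)) {u : ℝ} (hu : 0 < u) :
    HasDerivAt (fun u => heatFlow u ψ y) (heatFlow u (laplace ψ) y) u := by
  have hrep : (fun u => heatFlow u ψ y) =ᶠ[𝓝 u]
      fun u => ∫ z, heatKernel 1 z * ψ (y + √u • z) := by
    filter_upwards [lt_mem_nhds hu] with v hv
    exact integral_comp_sqrt_smul hv fun z => ψ (y + z)
  obtain ⟨C, hC⟩ := ((ψ.hasCompactSupport.fderiv ℝ).exists_bound_of_continuous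
    (ψ.contDiff.continuous_fderiv (by simp)))
  -- On `Ioi (u / 4)` one has `√u ≤ 2 * √v`, so the chain-rule factor `1 / (2 * √v)` is at most `1 /
  -- √u`; this gives a dominating function independent of `v`.
  have hder := hasDerivAt_integral_of_dominated_loc_of_deriv_le (μ := volume) (x₀ := u)
    (s := Ioi (u / 4))
    (F := fun u (z : EuclideanSpace ℝ (Fin n)) => heatKernel 1 z * ψ (y + √u • z))
    (F' := fun u z => heatKernel 1 z * (fderiv ℝ ψ (y + √u • z) ((1 / (2 * √u)) • z)))
    (bound := fun z => C * (1 / √u) * (‖z‖ * heatKernel 1 z))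
    (Ioi_mem_nhds (by linarith)) ?_ ?_ ?_ ?_ ?_ ?_
  · refine (hder.2.congr_of_eventuallyEq hrep).congr_deriv ?_
    have h1 : ∀ z, heatKernel 1 z * (fderiv ℝ ψ (y + √u • z) ((1 / (2 * √u)) • z))
        = heatKernel 1 z * (∑ i, (√u • z) i / (2 * u) * partialDeriv i ψ (y + √u • z)) := by
      intro z
      have hz : z = ∑ i, z i • EuclideanSpace.single i (1 : ℝ) := by
        ext j; simp [Finset.sum_apply, Pi.single_apply]
      congr 1
      rw [map_smul]
      conv_lhs => rw [hz, map_sum]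
      rw [Finset.smul_sum]
      refine Finset.sum_congr rfl fun i _ => ?_
      rw [map_smul, partialDeriv_apply, ← hz]
      have hsu : √u ≠ 0 := (Real.sqrt_pos.2 hu).ne'
      simp only [smul_eq_mul, PiLp.smul_apply]
      have hsu2 : √u / (2 * u) = 1 / (2 * √u) := by
        rw [div_eq_div_iff (by positivity) (by positivity)]
        linear_combination 2 * Real.mul_self_sqrt hu.le
      linear_combination -(z i * fderiv ℝ ψ (y + √u • z) (EuclideanSpace.single i 1)) * hsu2
    simp_rw [h1]
    rw [← integral_comp_sqrt_smul hu fun z => ∑ i, z i / (2 * u) * partialDeriv i ψ (y + z)]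
    -- The factor `z i / (2 * u)` left by the chain rule turns the heat kernel into `gradKernel`;
    -- integration by parts then yields one more derivative, and the sum over `i` is the Laplacian.
    have h2 : ∀ i, ∀ z, heatKernel u z * (z i / (2 * u) * partialDeriv i ψ (y + z))
        = gradKernel i u z * partialDeriv i ψ (y + z) := fun i z => by rw [gradKernel]; ring
    simp_rw [Finset.mul_sum, h2]
    rw [integral_finsetSum _ fun i _ => integrable_mul_test (integrable_gradKernel i hu) _ y]
    simp_rw [heatFlow, laplace_apply, Finset.mul_sum]
    rw [integral_finsetSum _ fun i _ => integrable_mul_test (integrable_heatKernel hu) _ y]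
    exact Finset.sum_congr rfl fun i _ => (heatFlow_partialDeriv i hu _ y).symm
  · refine Eventually.of_forall fun v => Continuous.aestronglyMeasurable ?_
    have := continuous_heatKernel (n := n) 1
    have := ψ.continuous
    fun_prop
  · obtain ⟨D, -, hD⟩ := ψ.exists_bound
    exact (integrable_heatKernel one_pos).mul_bdd (c := D)
      (ψ.continuous.comp (by fun_prop)).aestronglyMeasurable (ae_of_all _ fun z => hD _)
  · refine Continuous.aestronglyMeasurable ?_
    have h1 := continuous_heatKernel (n := n) 1
    have h2 := ψ.contDiff.continuous_fderiv (by simp)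
    exact h1.mul ((h2.comp (by fun_prop)).clm_apply (by fun_prop))
  · refine ae_of_all _ fun z v (hv : u / 4 < v) => ?_
    have hv0 : 0 < v := by linarith
    have hsv : 0 < √v := Real.sqrt_pos.2 hv0
    have hsu : 0 < √u := Real.sqrt_pos.2 hu
    have h2 : √u ≤ 2 * √v := by
      have : √(u / 4) ≤ √v := Real.sqrt_le_sqrt hv.le
      rw [Real.sqrt_div hu.le, show (4 : ℝ) = 2 ^ 2 by norm_num,
        Real.sqrt_sq (by norm_num)] at this
      linarith
    rw [norm_mul, Real.norm_of_nonneg (heatKernel_nonneg one_pos z)]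
    have h3 : ‖fderiv ℝ ψ (y + √v • z) ((1 / (2 * √v)) • z)‖ ≤ C * (1 / √u * ‖z‖) := by
      refine (ContinuousLinearMap.le_opNorm _ _).trans ?_
      refine mul_le_mul (hC _) ?_ (norm_nonneg _) ((norm_nonneg _).trans (hC 0))
      rw [norm_smul, Real.norm_of_nonneg (by positivity)]
      gcongr
    calc _ ≤ heatKernel 1 z * (C * (1 / √u * ‖z‖)) :=
          mul_le_mul_of_nonneg_left h3 (heatKernel_nonneg one_pos z)
      _ = _ := by ring
  · exact integrable_norm_mul_heatKernel.const_mul _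
  · refine ae_of_all _ fun z v (hv : u / 4 < v) => ?_
    have hv0 : 0 < v := by linarith
    have h1 : HasDerivAt (fun v => y + √v • z) ((1 / (2 * √v)) • z) v :=
      ((Real.hasDerivAt_sqrt hv0.ne').smul_const z).const_add y
    exact ((ψ.differentiable _).hasFDerivAt.comp_hasDerivAt v h1).const_mul _

theorem tendsto_heatFlow_nhdsGT (ψ : Test n) (y : EuclideanSpace ℝ (Fin n)) :
    Tendsto (fun u => heatFlow u ψ y) (𝓝[>] 0) (𝓝 (ψ y)) := by
  obtain ⟨D, -, hD⟩ := ψ.exists_bound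
  have h : Tendsto (fun u : ℝ => ∫ z, heatKernel 1 z * ψ (y + √u • z)) (𝓝[>] 0)
      (𝓝 (∫ z : EuclideanSpace ℝ (Fin n), heatKernel 1 z * ψ y)) := by
    refine tendsto_integral_filter_of_dominated_convergence (fun z => heatKernel 1 z * D) ?_ ?_ ?_ ?_
    · refine Eventually.of_forall fun v => Continuous.aestronglyMeasurable ?_
      have := continuous_heatKernel (n := n) 1
      have := ψ.continuous
      fun_prop
    · refine Eventually.of_forall fun v => ae_of_all _ fun z => ?_
      rw [norm_mul, Real.norm_of_nonneg (heatKernel_nonneg one_pos z)]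
      exact mul_le_mul_of_nonneg_left (hD _) (heatKernel_nonneg one_pos z)
    · exact (integrable_heatKernel one_pos).mul_const _
    · refine ae_of_all _ fun z => ?_
      have hc : Continuous fun u : ℝ => heatKernel 1 z * ψ (y + √u • z) := by
        have := ψ.continuous
        fun_prop
      have := hc.tendsto 0
      simp only [Real.sqrt_zero, zero_smul, add_zero] at this
      exact this.mono_left nhdsWithin_le_nhds
  rw [integral_mul_const, integral_heatKernel one_pos, one_mul] at h
  refine h.congr' ?_
  filter_upwards [self_mem_nhdsWithin] with v hv
  exact (integral_comp_sqrt_smul hv fun z => ψ (y + z)).symm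

/-- The kernel is at most a multiple of `u ^ (-n/2)`, which decays only in positive dimension. -/
theorem tendsto_heatFlow_atTop (hn : n ≠ 0) (ψ : Test n) (y : EuclideanSpace ℝ (Fin n)) :
    Tendsto (fun u => heatFlow u ψ y) atTop (𝓝 0) := by
  have hb : ∀ᶠ u : ℝ in atTop, ‖heatFlow u ψ y‖
      ≤ (4 * Real.pi * u) ^ (-((n : ℝ) / 2)) * ∫ z, |ψ (y + z)| := by
    filter_upwards [eventually_gt_atTop 0] with u hu
    have hi : Integrable fun z => |ψ (y + z)| := (ψ.integrable.comp_add_left y).abs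
    rw [← integral_const_mul]
    refine norm_integral_le_of_norm_le (hi.const_mul _) (ae_of_all _ fun z => ?_)
    rw [norm_mul, Real.norm_of_nonneg (heatKernel_nonneg hu z), ← neg_div]
    exact mul_le_mul_of_nonneg_right (heatKernel_le hu z) (norm_nonneg _)
  refine squeeze_zero_norm' hb ?_
  rw [← zero_mul (∫ z, |ψ (y + z)|)]
  refine Tendsto.mul_const _ ?_
  have hn' : 0 < (n : ℝ) / 2 := by positivity
  exact (tendsto_rpow_neg_atTop hn').comp (tendsto_id.const_mul_atTop (by positivity))

/-! ### Bounds for the heat flow in `L¹` and in the sup norm. -/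

theorem lintegral_enorm_integral_mul_le {k : EuclideanSpace ℝ (Fin n) → ℝ} (hk : Measurable k)
    {ψ : EuclideanSpace ℝ (Fin n) → ℝ} (hψ : Measurable ψ) :
    ∫⁻ x, ‖∫ z, k z * ψ (x + z)‖ₑ ≤ (∫⁻ z, ‖k z‖ₑ) * ∫⁻ x, ‖ψ x‖ₑ := by
  calc _ ≤ ∫⁻ x, ∫⁻ z, ‖k z‖ₑ * ‖ψ (x + z)‖ₑ := by
        refine lintegral_mono fun x => (enorm_integral_le_lintegral_enorm _).trans_eq ?_
        simp_rw [enorm_mul]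
    _ = ∫⁻ z, ∫⁻ x, ‖k z‖ₑ * ‖ψ (x + z)‖ₑ := by
        refine lintegral_lintegral_swap (Measurable.aemeasurable ?_)
        fun_prop
    _ = ∫⁻ z, ‖k z‖ₑ * ∫⁻ x, ‖ψ x‖ₑ := by
        refine lintegral_congr fun z => ?_
        rw [lintegral_const_mul _ (by fun_prop),
          lintegral_add_right_eq_self (fun x => ‖ψ x‖ₑ) z]
    _ = _ := lintegral_mul_const _ (by fun_prop)

theorem abs_integral_mul_le {k : EuclideanSpace ℝ (Fin n) → ℝ} (hk : Integrable k)
    {ψ : EuclideanSpace ℝ (Fin n) → ℝ} {C : ℝ} (hψ : ∀ x, |ψ x| ≤ C)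
    (x : EuclideanSpace ℝ (Fin n)) :
    |∫ z, k z * ψ (x + z)| ≤ (∫ z, |k z|) * C := by
  rw [← integral_mul_const, ← Real.norm_eq_abs]
  refine norm_integral_le_of_norm_le (hk.abs.mul_const C) (ae_of_all _ fun z => ?_)
  rw [norm_mul]
  exact mul_le_mul_of_nonneg_left (hψ _) (abs_nonneg _)

theorem integral_abs_heatKernel {s : ℝ} (hs : 0 < s) :
    ∫ z : EuclideanSpace ℝ (Fin n), |heatKernel s z| = 1 := by
  simp_rw [abs_of_nonneg (heatKernel_nonneg hs _), integral_heatKernel hs]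

theorem integral_abs_gradKernel_le (i : Fin n) {s : ℝ} (hs : 0 < s) :
    ∫ z, |gradKernel i s z| ≤ (2 : ℝ) ^ ((n : ℝ) / 2) * s ^ (-(1 / 2) : ℝ) := by
  calc _ ≤ ∫ z : EuclideanSpace ℝ (Fin n),
        (2 : ℝ) ^ ((n : ℝ) / 2) * s ^ (-(1 / 2) : ℝ) * heatKernel (2 * s) z :=
        integral_mono (integrable_gradKernel i hs).abs
          ((integrable_heatKernel (by positivity)).const_mul _) (abs_gradKernel_le i hs)
    _ = _ := by rw [integral_const_mul, integral_heatKernel (by positivity), mul_one]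

theorem lintegral_enorm_heatFlow_le (ψ : Test n) {u : ℝ} (hu : 0 < u) :
    ∫⁻ x, ‖heatFlow u ψ x‖ₑ ≤ ∫⁻ x, ‖ψ x‖ₑ := by
  refine (lintegral_enorm_integral_mul_le (continuous_heatKernel u).measurable
    ψ.continuous.measurable).trans_eq ?_
  rw [← ofReal_integral_norm_eq_lintegral_enorm (integrable_heatKernel hu)]
  simp [integral_abs_heatKernel hu]

/-- The derivative is moved onto the kernel; the resulting decay `u ^ (-1/2)` is what makes the
integral over large times converge. -/
theorem lintegral_enorm_heatFlow_partialDeriv_le (i : Fin n) (φ : Test n) {u : ℝ} (hu : 0 < u) :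
    ∫⁻ x, ‖heatFlow u (partialDeriv i φ) x‖ₑ
      ≤ ENNReal.ofReal ((2 : ℝ) ^ ((n : ℝ) / 2) * u ^ (-(1 / 2) : ℝ)) * ∫⁻ x, ‖φ x‖ₑ := by
  simp_rw [heatFlow_partialDeriv i hu]
  refine (lintegral_enorm_integral_mul_le (continuous_gradKernel i u).measurable
    φ.continuous.measurable).trans (mul_le_mul_left ?_ _)
  rw [← ofReal_integral_norm_eq_lintegral_enorm (integrable_gradKernel i hu)]
  exact ENNReal.ofReal_le_ofReal (integral_abs_gradKernel_le i hu)

theorem abs_heatFlow_le {ψ : EuclideanSpace ℝ (Fin n) → ℝ} {C : ℝ} (hψ : ∀ x, |ψ x| ≤ C) {u : ℝ}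
    (hu : 0 < u) (x : EuclideanSpace ℝ (Fin n)) : |heatFlow u ψ x| ≤ C := by
  have := abs_integral_mul_le (integrable_heatKernel hu) hψ x
  rwa [integral_abs_heatKernel hu, one_mul] at this

theorem abs_heatFlow_partialDeriv_le (i : Fin n) (φ : Test n) {C : ℝ} (hφ : ∀ x, |φ x| ≤ C)
    {u : ℝ} (hu : 0 < u) (x : EuclideanSpace ℝ (Fin n)) :
    |heatFlow u (partialDeriv i φ) x| ≤ (2 : ℝ) ^ ((n : ℝ) / 2) * u ^ (-(1 / 2) : ℝ) * C := by
  rw [heatFlow_partialDeriv i hu]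
  exact (abs_integral_mul_le (integrable_gradKernel i hu) hφ x).trans
    (mul_le_mul_of_nonneg_right (integral_abs_gradKernel_le i hu)
      ((abs_nonneg _).trans (hφ 0)))

/-! ### Finite differences in time of the heat flow. -/

section differences

theorem hasDerivAt_fwdDiff_heatFlow (ψ : Test n) (x : EuclideanSpace ℝ (Fin n)) {r : ℝ}
    (hr : 0 < r) (m : ℕ) {t : ℝ} (ht : 0 < t) :
    HasDerivAt ((fwdDiff r)^[m] fun u => heatFlow u ψ x)
      ((fwdDiff r)^[m] (fun u => heatFlow u (laplace ψ) x) t) t := by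
  induction m generalizing t with
  | zero => exact hasDerivAt_heatFlow ψ x ht
  | succ m ih =>
    simp only [Function.iterate_succ_apply']
    exact (HasDerivAt.comp_add_const t r (ih (by linarith))).sub (ih ht)

theorem measurable_fwdDiff_heatFlow (ψ : Test n) (r : ℝ) (m : ℕ) :
    Measurable fun p : ℝ × EuclideanSpace ℝ (Fin n) =>
      (fwdDiff r)^[m] (fun u => heatFlow u ψ p.2) p.1 := by
  induction m with
  | zero => exact measurable_heatFlow ψ
  | succ m ih =>
    simp only [Function.iterate_succ_apply', fwdDiff]
    exact (ih.comp (f := fun p : ℝ × EuclideanSpace ℝ (Fin n) => (p.1 + r, p.2))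
      (by fun_prop)).sub ih

theorem fwdDiff_succ_heatFlow (ψ : Test n) (x : EuclideanSpace ℝ (Fin n)) {r : ℝ}
    (hr : 0 < r) (m : ℕ) {u : ℝ} (hu : 0 < u) :
    (fwdDiff r)^[m + 1] (fun u => heatFlow u ψ x) u
      = ∫ t in u..(u + r), (fwdDiff r)^[m] (fun u => heatFlow u (laplace ψ) x) t := by
  have hpos : ∀ t ∈ uIcc u (u + r), 0 < t := by
    intro t ht
    rw [uIcc_of_le (by linarith)] at ht
    linarith [ht.1]
  rw [intervalIntegral.integral_eq_sub_of_hasDerivAt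
    (fun t ht => hasDerivAt_fwdDiff_heatFlow ψ x hr m (hpos t ht)),
    Function.iterate_succ_apply']
  · rfl
  · refine ContinuousOn.intervalIntegrable fun t ht => ?_
    exact (hasDerivAt_fwdDiff_heatFlow _ x hr m (hpos t ht)).continuousAt.continuousWithinAt

/-- By the heat equation each difference is an integral over a time interval of length `r` of the
flow of the Laplacian, so it gains a factor `r` and costs one Laplacian; the flow itself contracts
`L¹`. -/
theorem lintegral_fwdDiff_heatFlow_le (m : ℕ) (ψ : Test n) {r u : ℝ} (hr : 0 < r) (hu : 0 < u) :
    ∫⁻ x, ‖(fwdDiff r)^[m] (fun u => heatFlow u ψ x) u‖ₑ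
      ≤ ENNReal.ofReal r ^ m * ∫⁻ x, ‖(laplace^[m]) ψ x‖ₑ := by
  induction m generalizing ψ u with
  | zero => simpa using lintegral_enorm_heatFlow_le ψ hu
  | succ m ih =>
    calc _ ≤ ∫⁻ x, ∫⁻ t in Ioc u (u + r),
          ‖(fwdDiff r)^[m] (fun u => heatFlow u (laplace ψ) x) t‖ₑ := by
          refine lintegral_mono fun x => ?_
          rw [fwdDiff_succ_heatFlow ψ x hr m hu, intervalIntegral.integral_of_le (by linarith)]
          exact enorm_integral_le_lintegral_enorm _
      _ = ∫⁻ t in Ioc u (u + r), ∫⁻ x,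
          ‖(fwdDiff r)^[m] (fun u => heatFlow u (laplace ψ) x) t‖ₑ := by
          refine lintegral_lintegral_swap (Measurable.aemeasurable ?_)
          exact ((measurable_fwdDiff_heatFlow (laplace ψ) r m).comp measurable_swap).enorm
      _ ≤ ∫⁻ t in Ioc u (u + r),
          ENNReal.ofReal r ^ m * ∫⁻ x, ‖(laplace^[m]) (laplace ψ) x‖ₑ :=
          setLIntegral_mono' measurableSet_Ioc fun t ht => ih (laplace ψ) (hu.trans ht.1)
      _ = _ := by
          rw [setLIntegral_const, Real.volume_Ioc, add_sub_cancel_left, pow_succ,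
            Function.iterate_succ_apply]
          ring

theorem abs_fwdDiff_heatFlow_le (m : ℕ) (ψ : Test n) {C : ℝ} (hC : ∀ x, |(laplace^[m]) ψ x| ≤ C)
    {r u : ℝ} (hr : 0 < r) (hu : 0 < u) (x : EuclideanSpace ℝ (Fin n)) :
    |(fwdDiff r)^[m] (fun u => heatFlow u ψ x) u| ≤ r ^ m * C := by
  induction m generalizing ψ u with
  | zero => simpa using abs_heatFlow_le hC hu x
  | succ m ih =>
    rw [fwdDiff_succ_heatFlow ψ x hr m hu]
    have := intervalIntegral.norm_integral_le_of_norm_le_const (a := u) (b := u + r)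
      (C := r ^ m * C) (f := fun t => (fwdDiff r)^[m] (fun u => heatFlow u (laplace ψ) x) t) ?_
    · refine this.trans_eq ?_
      rw [add_sub_cancel_left, abs_of_pos hr]; ring
    · intro t ht
      rw [uIoc_of_le (by linarith)] at ht
      exact ih (laplace ψ) hC (hu.trans ht.1)

end differences

/-- The coefficients of the `m`-th forward difference. -/
def diffCoeff (m k : ℕ) : ℝ := (-1) ^ (m - k) * m.choose k

theorem fwdDiff_iter_eq_sum_diffCoeff (m : ℕ) (f : ℝ → ℝ) (h y : ℝ) :
    (fwdDiff h)^[m] f y = ∑ k ∈ Finset.range (m + 1), diffCoeff m k * f (y + k * h) := by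
  rw [fwdDiff_iter_eq_sum_shift]
  refine Finset.sum_congr rfl fun k _ => ?_
  simp [diffCoeff]

/-- The difference of order `n` of `u ↦ exp (u Δ) ∂ᵢ φ` at `r` with step `r`. -/
def heatDiff (i : Fin n) (φ : Test n) (r : ℝ) (x : EuclideanSpace ℝ (Fin n)) : ℝ :=
  ∑ k ∈ Finset.range (n + 1), diffCoeff n k * heatFlow ((k + 1) * r) (partialDeriv i φ) x

theorem heatDiff_eq (i : Fin n) (φ : Test n) (r : ℝ) (x : EuclideanSpace ℝ (Fin n)) :
    heatDiff i φ r x = (fwdDiff r)^[n] (fun u => heatFlow u (partialDeriv i φ) x) r := by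
  rw [fwdDiff_iter_eq_sum_diffCoeff, heatDiff]
  refine Finset.sum_congr rfl fun k _ => ?_
  congr 2; ring

theorem measurable_heatDiff (i : Fin n) (φ : Test n) :
    Measurable fun p : ℝ × EuclideanSpace ℝ (Fin n) => heatDiff i φ p.1 p.2 := by
  unfold heatDiff
  refine Finset.measurable_sum _ fun k _ => Measurable.const_mul ?_ _
  exact (measurable_heatFlow (partialDeriv i φ)).comp
    (f := fun p : ℝ × EuclideanSpace ℝ (Fin n) => ((k + 1) * p.1, p.2)) (by fun_prop)

/-- The size of `heatDiff` as a function of `r`. -/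
def heatWeight (n : ℕ) (r : ℝ) : ℝ := if r ≤ 1 then r ^ n else r ^ (-(1 / 2) : ℝ)

theorem heatWeight_nonneg {r : ℝ} (hr : 0 < r) : 0 ≤ heatWeight n r := by
  unfold heatWeight; split_ifs <;> positivity

theorem measurable_heatWeight : Measurable (heatWeight n) := by
  unfold heatWeight
  exact Measurable.ite measurableSet_Iic (by fun_prop) (by fun_prop)

/-- The constant in the estimates of `heatDiff` for large `r`. -/
def heatConst (n : ℕ) : ℝ :=
  ∑ k ∈ Finset.range (n + 1), |diffCoeff n k| * (2 : ℝ) ^ ((n : ℝ) / 2)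

theorem heatConst_nonneg : 0 ≤ heatConst n := by unfold heatConst; positivity

theorem rpow_neg_half_mul_le (k : ℕ) {r : ℝ} (hr : 0 < r) :
    ((k + 1 : ℝ) * r) ^ (-(1 / 2) : ℝ) ≤ r ^ (-(1 / 2) : ℝ) := by
  refine Real.rpow_le_rpow_of_nonpos hr ?_ (by norm_num)
  have : (0 : ℝ) ≤ k := by positivity
  nlinarith

/-- For `r ≤ 1` the cancellation in the difference of order `n` gives `r ^ n`. For `r > 1` the terms
are bounded one by one, each by the decay `r ^ (-1/2)` of the derivative. The two constants are
added so that one bound covers both ranges. -/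
theorem lintegral_enorm_heatDiff_le (i : Fin n) (φ : Test n) {r : ℝ} (hr : 0 < r) :
    ∫⁻ x, ‖heatDiff i φ r x‖ₑ ≤ ENNReal.ofReal (heatWeight n r) *
      ((∫⁻ x, ‖(laplace^[n]) (partialDeriv i φ) x‖ₑ)
        + ENNReal.ofReal (heatConst n) * ∫⁻ x, ‖φ x‖ₑ) := by
  unfold heatWeight
  split_ifs with h
  · rw [mul_add]
    refine le_add_right ?_
    simp_rw [heatDiff_eq]
    refine (lintegral_fwdDiff_heatFlow_le n _ hr hr).trans_eq ?_
    rw [ENNReal.ofReal_pow hr.le]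
  · rw [mul_add]
    refine le_add_left ?_
    calc _ ≤ ∫⁻ x, ∑ k ∈ Finset.range (n + 1),
          ‖diffCoeff n k‖ₑ * ‖heatFlow ((k + 1) * r) (partialDeriv i φ) x‖ₑ := by
          refine lintegral_mono fun x => (enorm_sum_le _ _).trans_eq ?_
          simp_rw [enorm_mul]
      _ = ∑ k ∈ Finset.range (n + 1),
          ‖diffCoeff n k‖ₑ * ∫⁻ x, ‖heatFlow ((k + 1) * r) (partialDeriv i φ) x‖ₑ := by
          have hm : ∀ k : ℕ, Measurable fun x =>
              ‖heatFlow ((k + 1) * r) (partialDeriv i φ) x‖ₑ := fun k =>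
            ((measurable_heatFlow (partialDeriv i φ)).comp
              (f := fun x => (((k + 1) * r : ℝ), x)) (by fun_prop)).enorm
          rw [lintegral_finsetSum _ fun k _ => (hm k).const_mul _]
          exact Finset.sum_congr rfl fun k _ => lintegral_const_mul _ (hm k)
      _ ≤ ∑ k ∈ Finset.range (n + 1), ENNReal.ofReal (|diffCoeff n k| * (2 : ℝ) ^ ((n : ℝ) / 2))
          * (ENNReal.ofReal (r ^ (-(1 / 2) : ℝ)) * ∫⁻ x, ‖φ x‖ₑ) := by
          refine Finset.sum_le_sum fun k _ => ?_
          rw [ENNReal.ofReal_mul (abs_nonneg _), ← Real.enorm_eq_ofReal_abs, mul_assoc,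
            ← mul_assoc (ENNReal.ofReal _), ← ENNReal.ofReal_mul (by positivity)]
          refine mul_le_mul_right ((lintegral_enorm_heatFlow_partialDeriv_le i φ
            (u := (k + 1) * r) (by positivity)).trans (mul_le_mul_left ?_ _)) _
          exact ENNReal.ofReal_le_ofReal
            (mul_le_mul_of_nonneg_left (rpow_neg_half_mul_le k hr) (by positivity))
      _ = _ := by
          rw [← Finset.sum_mul, heatConst,
            ENNReal.ofReal_sum_of_nonneg fun k _ => by positivity]
          ring

theorem exists_abs_heatDiff_le (i : Fin n) (φ : Test n) :
    ∃ C, 0 ≤ C ∧ ∀ r, 0 < r → ∀ x, |heatDiff i φ r x| ≤ heatWeight n r * C := by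
  obtain ⟨A, hA0, hA⟩ := ((laplace^[n]) (partialDeriv i φ)).exists_bound
  obtain ⟨B, hB0, hB⟩ := φ.exists_bound
  refine ⟨A + heatConst n * B, add_nonneg hA0 (mul_nonneg heatConst_nonneg hB0),
    fun r hr x => ?_⟩
  rw [mul_add]
  unfold heatWeight
  split_ifs with h
  · have h1 := abs_fwdDiff_heatFlow_le n (partialDeriv i φ) hA hr hr x
    rw [← heatDiff_eq] at h1
    have : 0 ≤ r ^ n * (heatConst n * B) := mul_nonneg (by positivity)
      (mul_nonneg heatConst_nonneg hB0)
    linarith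
  · have h1 : |heatDiff i φ r x| ≤ r ^ (-(1 / 2) : ℝ) * (heatConst n * B) := by
      calc _ ≤ ∑ k ∈ Finset.range (n + 1),
            |diffCoeff n k * heatFlow ((k + 1) * r) (partialDeriv i φ) x| :=
            Finset.abs_sum_le_sum_abs _ _
        _ ≤ ∑ k ∈ Finset.range (n + 1), (|diffCoeff n k| * (2 : ℝ) ^ ((n : ℝ) / 2))
            * (r ^ (-(1 / 2) : ℝ) * B) := by
            refine Finset.sum_le_sum fun k _ => ?_
            rw [abs_mul, mul_assoc]
            refine mul_le_mul_of_nonneg_left ?_ (abs_nonneg _)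
            refine (abs_heatFlow_partialDeriv_le i φ hB (u := (k + 1) * r)
              (by positivity) x).trans ?_
            rw [← mul_assoc]
            exact mul_le_mul_of_nonneg_right
              (mul_le_mul_of_nonneg_left (rpow_neg_half_mul_le k hr) (by positivity)) hB0
        _ = _ := by rw [← Finset.sum_mul, heatConst]; ring
    have : 0 ≤ r ^ (-(1 / 2) : ℝ) * A := by positivity
    linarith

/-! ### The inverse Riesz transform as a bounded integrable function. -/

/-- The exponent `(n + 1 - α) / 2`. -/
def heatExp (n : ℕ) (α : ℝ) : ℝ := (n + 1 - α) / 2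

/-- Near `0` the exponent is `n - heatExp n α = (n - 1 + α) / 2 > -1`; at infinity it is `-heatExp n
α - 1 / 2`, which is below `-1` exactly when `α < n`. -/
theorem integrableOn_rpow_mul_heatWeight {α : ℝ} (hα0 : 0 < α) (hαn : α < n) :
    IntegrableOn (fun r => r ^ (-heatExp n α) * heatWeight n r) (Ioi 0) := by
  have hn : (1 : ℝ) ≤ n := by
    have : 0 < n := by
      have := hα0.trans hαn
      exact_mod_cast this
    exact_mod_cast this
  rw [← Ioc_union_Ioi_eq_Ioi zero_le_one]
  refine IntegrableOn.union ?_ ?_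
  · have h : IntegrableOn (fun r : ℝ => r ^ (n - heatExp n α)) (Ioc 0 1) := by
      rw [← intervalIntegrable_iff_integrableOn_Ioc_of_le zero_le_one]
      refine intervalIntegral.intervalIntegrable_rpow' ?_
      unfold heatExp; linarith
    refine h.congr_fun (fun r hr => ?_) measurableSet_Ioc
    simp only [heatWeight, if_pos hr.2]
    rw [← Real.rpow_natCast, ← Real.rpow_add hr.1]
    congr 1; ring
  · have h : IntegrableOn (fun r : ℝ => r ^ (-heatExp n α - 1 / 2)) (Ioi 1) := by
      refine integrableOn_Ioi_rpow_of_lt ?_ one_pos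
      unfold heatExp; linarith
    refine h.congr_fun (fun r (hr : 1 < r) => ?_) measurableSet_Ioi
    simp only [heatWeight, if_neg (not_le.2 hr)]
    rw [← Real.rpow_add (by linarith)]
    congr 1

/-- The `i`-th component of the inverse Riesz transform of a test function, up to a constant. -/
def rieszInverse (α : ℝ) (i : Fin n) (φ : Test n) (x : EuclideanSpace ℝ (Fin n)) : ℝ :=
  ∫ r in Ioi (0 : ℝ), r ^ (-heatExp n α) * heatDiff i φ r x

theorem measurable_rieszInverse (α : ℝ) (i : Fin n) (φ : Test n) :
    Measurable (rieszInverse α i φ) := by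
  have h : StronglyMeasurable fun p : EuclideanSpace ℝ (Fin n) × ℝ =>
      p.2 ^ (-heatExp n α) * heatDiff i φ p.2 p.1 := by
    have := (measurable_heatDiff i φ).comp
      (measurable_swap (α := EuclideanSpace ℝ (Fin n)) (β := ℝ))
    exact Measurable.stronglyMeasurable (by fun_prop)
  exact h.integral_prod_right.measurable

theorem exists_abs_rieszInverse_le {α : ℝ} (hα0 : 0 < α) (hαn : α < n) (i : Fin n) (φ : Test n) :
    ∃ C, 0 ≤ C ∧ ∀ x, |rieszInverse α i φ x| ≤ C := by
  obtain ⟨C, hC0, hC⟩ := exists_abs_heatDiff_le i φ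
  have h0 : 0 ≤ ∫ r in Ioi (0 : ℝ), r ^ (-heatExp n α) * heatWeight n r :=
    setIntegral_nonneg measurableSet_Ioi fun r (hr : 0 < r) =>
      mul_nonneg (by positivity) (heatWeight_nonneg hr)
  refine ⟨(∫ r in Ioi (0 : ℝ), r ^ (-heatExp n α) * heatWeight n r) * C,
    mul_nonneg h0 hC0, fun x => ?_⟩
  rw [← integral_mul_const, ← Real.norm_eq_abs]
  refine norm_integral_le_of_norm_le
    ((integrableOn_rpow_mul_heatWeight hα0 hαn).mul_const C) ?_
  refine (ae_restrict_iff' measurableSet_Ioi).2 (ae_of_all _ fun r (hr : 0 < r) => ?_)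
  rw [norm_mul, Real.norm_of_nonneg (by positivity), mul_assoc]
  exact mul_le_mul_of_nonneg_left (hC r hr x) (by positivity)

/-- The total mass of `heatDiff` against `r ^ (-heatExp n α)`. -/
theorem lintegral_lintegral_heatDiff_le {α : ℝ} (hα0 : 0 < α) (hαn : α < n) (i : Fin n)
    (φ : Test n) :
    ∫⁻ r in Ioi (0 : ℝ), ∫⁻ x, ‖r ^ (-heatExp n α) * heatDiff i φ r x‖ₑ
      ≤ ENNReal.ofReal (∫ r in Ioi (0 : ℝ), r ^ (-heatExp n α) * heatWeight n r) *
      ((∫⁻ x, ‖(laplace^[n]) (partialDeriv i φ) x‖ₑ)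
        + ENNReal.ofReal (heatConst n) * ∫⁻ x, ‖φ x‖ₑ) := by
  have h0 : ∀ r ∈ Ioi (0 : ℝ), 0 ≤ r ^ (-heatExp n α) * heatWeight n r :=
    fun r (hr : 0 < r) => mul_nonneg (by positivity) (heatWeight_nonneg hr)
  rw [ofReal_integral_eq_lintegral_ofReal (integrableOn_rpow_mul_heatWeight hα0 hαn)
    ((ae_restrict_iff' measurableSet_Ioi).2 (ae_of_all _ h0)),
    ← lintegral_mul_const _ (by
      have := measurable_heatWeight (n := n)
      fun_prop)]
  refine setLIntegral_mono' measurableSet_Ioi fun r (hr : 0 < r) => ?_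
  simp_rw [enorm_mul]
  rw [lintegral_const_mul _ (by
    exact ((measurable_heatDiff i φ).comp (f := fun x => (r, x)) (by fun_prop)).enorm),
    ENNReal.ofReal_mul (by positivity), mul_assoc, Real.enorm_of_nonneg (by positivity)]
  exact mul_le_mul_right (lintegral_enorm_heatDiff_le i φ hr) _

theorem lintegral_enorm_rieszInverse_le {α : ℝ} (hα0 : 0 < α) (hαn : α < n) (i : Fin n)
    (φ : Test n) :
    ∫⁻ x, ‖rieszInverse α i φ x‖ₑ
      ≤ ENNReal.ofReal (∫ r in Ioi (0 : ℝ), r ^ (-heatExp n α) * heatWeight n r) *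
      ((∫⁻ x, ‖(laplace^[n]) (partialDeriv i φ) x‖ₑ)
        + ENNReal.ofReal (heatConst n) * ∫⁻ x, ‖φ x‖ₑ) := by
  refine le_trans ?_ (lintegral_lintegral_heatDiff_le hα0 hαn i φ)
  calc _ ≤ ∫⁻ x, ∫⁻ r in Ioi (0 : ℝ), ‖r ^ (-heatExp n α) * heatDiff i φ r x‖ₑ :=
        lintegral_mono fun x => enorm_integral_le_lintegral_enorm _
    _ = _ := by
        refine lintegral_lintegral_swap (Measurable.aemeasurable ?_)
        have := (measurable_heatDiff i φ).comp
          (measurable_swap (α := EuclideanSpace ℝ (Fin n)) (β := ℝ))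
        exact Measurable.enorm (by fun_prop)

theorem Test.lintegral_enorm_lt_top (φ : Test n) : ∫⁻ x, ‖φ x‖ₑ < ⊤ := φ.integrable.2

theorem integrable_rieszInverse {α : ℝ} (hα0 : 0 < α) (hαn : α < n) (i : Fin n) (φ : Test n) :
    Integrable (rieszInverse α i φ) := by
  refine ⟨(measurable_rieszInverse α i φ).aestronglyMeasurable,
    (lintegral_enorm_rieszInverse_le hα0 hαn i φ).trans_lt ?_⟩
  have h1 := φ.lintegral_enorm_lt_top
  have h2 := Test.lintegral_enorm_lt_top ((laplace^[n]) (partialDeriv i φ))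
  exact ENNReal.mul_lt_top ENNReal.ofReal_lt_top
    (ENNReal.add_lt_top.2 ⟨h2, ENNReal.mul_lt_top ENNReal.ofReal_lt_top h1⟩)

/-! ### Subordination: the Riesz kernel as a superposition of heat kernel gradients. -/

/-- The radial profile in the representation of the Riesz kernel by heat kernels. -/
def subordProfile (n : ℕ) (α s : ℝ) : ℝ :=
  s ^ (heatExp n α - 1) * (1 / (2 * s) * ((4 * Real.pi * s) ^ (-(n : ℝ) / 2)
    * Real.exp (-1 / (4 * s))))

theorem subordProfile_eq (α : ℝ) {s : ℝ} (hs : 0 < s) :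
    subordProfile n α s = (1 / 2 * (4 * Real.pi) ^ (-(n : ℝ) / 2))
      * (s ^ (-(3 + α) / 2) * Real.exp (-1 / (4 * s))) := by
  have h : s ^ (heatExp n α - 1) * (1 / s) * s ^ (-(n : ℝ) / 2) = s ^ (-(3 + α) / 2) := by
    rw [one_div, ← Real.rpow_neg_one, ← Real.rpow_add hs, ← Real.rpow_add hs]
    congr 1; unfold heatExp; ring
  rw [subordProfile, Real.mul_rpow (by positivity) hs.le, ← h]
  field_simp

/-- The substitution `s ↦ 1 / s` turns the profile into a Gamma integrand `t ^ ((α - 1) / 2) * exp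
(-t / 4)`, up to a constant. -/
theorem integrableOn_subordProfile {α : ℝ} (hα0 : 0 < α) :
    IntegrableOn (subordProfile n α) (Ioi 0) := by
  have h1 : IntegrableOn (fun t : ℝ => t ^ ((α - 1) / 2) * Real.exp (-(1 / 4) * t ^ (1 : ℝ)))
      (Ioi 0) :=
    integrableOn_rpow_mul_exp_neg_mul_rpow (by linarith) one_pos (by norm_num)
  have h2 := (integrableOn_Ioi_comp_rpow_iff' (fun t : ℝ =>
    t ^ ((α - 1) / 2) * Real.exp (-(1 / 4) * t ^ (1 : ℝ))) (p := -1) (by norm_num)).2 h1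
  refine IntegrableOn.congr_fun
    (h2.const_mul (1 / 2 * (4 * Real.pi) ^ (-(n : ℝ) / 2))) (fun s (hs : 0 < s) => ?_)
    measurableSet_Ioi
  rw [subordProfile_eq α hs]
  simp only [smul_eq_mul, Real.rpow_one]
  rw [← mul_assoc (s ^ _), ← Real.rpow_mul hs.le, ← Real.rpow_add hs, Real.rpow_neg_one]
  congr 3
  · ring
  · field_simp

/-- The constant in the representation of the Riesz kernel by heat kernels. -/
def subordConst (n : ℕ) (α : ℝ) : ℝ := ∫ s in Ioi (0 : ℝ), subordProfile n α s

theorem subordProfile_pos (α : ℝ) {s : ℝ} (hs : 0 < s) : 0 < subordProfile n α s := by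
  unfold subordProfile; positivity

theorem setIntegral_Ioi_pos {f : ℝ → ℝ} (hf : ∀ s, 0 < s → 0 < f s)
    (hfi : IntegrableOn f (Ioi 0)) : 0 < ∫ s in Ioi 0, f s := by
  rw [setIntegral_pos_iff_support_of_nonneg_ae _ hfi]
  · have : Ioi (0 : ℝ) ⊆ Function.support f ∩ Ioi 0 := fun s hs => ⟨(hf s hs).ne', hs⟩
    exact lt_of_lt_of_le (by simp) (measure_mono this)
  · exact (ae_restrict_iff' measurableSet_Ioi).2 (ae_of_all _ fun s hs => (hf s hs).le)

theorem subordConst_pos {α : ℝ} (hα0 : 0 < α) : 0 < subordConst n α :=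
  setIntegral_Ioi_pos (fun _ hs => subordProfile_pos α hs) (integrableOn_subordProfile hα0)

/-- Parabolic scaling leaves `z` only in a homogeneous prefactor and in the time scale. Integrating
in `s` contributes a further `‖z‖ ^ 2`, which raises the exponent `-(3 + α)` to the `-(1 + α)` of
the Riesz kernel. -/
theorem rpow_mul_gradKernel (α : ℝ) (i : Fin n) {z : EuclideanSpace ℝ (Fin n)} (hz : z ≠ 0)
    {s : ℝ} (hs : 0 < s) :
    s ^ (heatExp n α - 1) * gradKernel i s z
      = z i * ‖z‖ ^ (-(3 + α)) * subordProfile n α ((‖z‖ ^ 2)⁻¹ * s) := by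
  have hz0 : 0 < ‖z‖ := norm_pos_iff.2 hz
  rw [subordProfile_eq α (by positivity), Real.mul_rpow (by positivity) hs.le]
  have h : s ^ (heatExp n α - 1) * (1 / s) * s ^ (-(n : ℝ) / 2) = s ^ (-(3 + α) / 2) := by
    rw [one_div, ← Real.rpow_neg_one, ← Real.rpow_add hs, ← Real.rpow_add hs]
    congr 1; unfold heatExp; ring
  have h2 : ‖z‖ ^ (-(3 + α)) * ((‖z‖ ^ 2)⁻¹) ^ (-(3 + α) / 2) = 1 := by
    rw [← Real.rpow_natCast, ← Real.rpow_neg hz0.le, ← Real.rpow_mul hz0.le,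
      ← Real.rpow_add hz0]
    convert Real.rpow_zero _ using 2
    push_cast; ring
  have h3 : -1 / (4 * ((‖z‖ ^ 2)⁻¹ * s)) = -‖z‖ ^ 2 / (4 * s) := by field_simp
  rw [gradKernel, heatKernel, h3, ← h, Real.mul_rpow (by positivity) hs.le]
  linear_combination -(z i * (1 / 2) * (4 * Real.pi) ^ (-(n : ℝ) / 2)
    * s ^ (heatExp n α - 1) * (1 / s) * s ^ (-(n : ℝ) / 2)
    * Real.exp (-‖z‖ ^ 2 / (4 * s))) * h2

theorem integrableOn_rpow_mul_gradKernel {α : ℝ} (hα0 : 0 < α) (i : Fin n)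
    (z : EuclideanSpace ℝ (Fin n)) :
    IntegrableOn (fun s => s ^ (heatExp n α - 1) * gradKernel i s z) (Ioi 0) := by
  rcases eq_or_ne z 0 with rfl | hz
  · simp [gradKernel]
  · have hz0 : 0 < ‖z‖ := norm_pos_iff.2 hz
    have h := (integrableOn_Ioi_comp_mul_left_iff (subordProfile n α) 0
      (a := (‖z‖ ^ 2)⁻¹) (by positivity)).2 (by simpa using integrableOn_subordProfile hα0)
    exact IntegrableOn.congr_fun (h.const_mul (z i * ‖z‖ ^ (-(3 + α))))
      (fun s hs => (rpow_mul_gradKernel α i hz hs).symm) measurableSet_Ioi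

theorem rpow_norm_mul_sq {α : ℝ} {z : EuclideanSpace ℝ (Fin n)} (hz0 : 0 < ‖z‖) :
    ‖z‖ ^ (-(3 + α)) * ‖z‖ ^ 2 = (‖z‖ ^ (1 + α))⁻¹ := by
  rw [← Real.rpow_natCast, ← Real.rpow_add hz0, ← Real.rpow_neg hz0.le]
  congr 1; push_cast; ring

theorem integral_rpow_mul_gradKernel (α : ℝ) (i : Fin n) (z : EuclideanSpace ℝ (Fin n)) :
    ∫ s in Ioi (0 : ℝ), s ^ (heatExp n α - 1) * gradKernel i s z
      = subordConst n α * rieszKernel α i z := by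
  rcases eq_or_ne z 0 with rfl | hz
  · simp [gradKernel, rieszKernel]
  · have hz0 : 0 < ‖z‖ := norm_pos_iff.2 hz
    rw [setIntegral_congr_fun measurableSet_Ioi fun s hs => rpow_mul_gradKernel α i hz hs,
      integral_const_mul, integral_comp_mul_left_Ioi _ _ (by positivity), inv_inv, mul_zero,
      smul_eq_mul, ← subordConst, rieszKernel, div_eq_mul_inv, ← rpow_norm_mul_sq hz0]
    ring

/-- For fixed `z` the integrand has the constant sign of `z i`, so nothing is lost by taking
absolute values inside. -/
theorem lintegral_enorm_rpow_mul_gradKernel {α : ℝ} (hα0 : 0 < α) (i : Fin n)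
    (z : EuclideanSpace ℝ (Fin n)) :
    ∫⁻ s in Ioi (0 : ℝ), ‖s ^ (heatExp n α - 1) * gradKernel i s z‖ₑ
      = ENNReal.ofReal (subordConst n α) * ‖rieszKernel α i z‖ₑ := by
  rw [← ofReal_integral_norm_eq_lintegral_enorm (integrableOn_rpow_mul_gradKernel hα0 i z),
    Real.enorm_eq_ofReal_abs, ← ENNReal.ofReal_mul (subordConst_pos hα0).le]
  congr 1
  rcases le_total 0 (z i) with h | h
  · rw [← abs_of_pos (subordConst_pos hα0), ← abs_mul, ← integral_rpow_mul_gradKernel,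
      abs_of_nonneg]
    · refine setIntegral_congr_fun measurableSet_Ioi fun s (hs : 0 < s) =>
        Real.norm_of_nonneg (mul_nonneg (by positivity) (mul_nonneg (by positivity)
          (heatKernel_nonneg hs z)))
    · exact setIntegral_nonneg measurableSet_Ioi fun s (hs : 0 < s) =>
        mul_nonneg (by positivity) (mul_nonneg (by positivity) (heatKernel_nonneg hs z))
  · have hneg : ∀ s, 0 < s → s ^ (heatExp n α - 1) * gradKernel i s z ≤ 0 := fun s hs =>
      mul_nonpos_of_nonneg_of_nonpos (by positivity) (mul_nonpos_of_nonpos_of_nonneg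
        (div_nonpos_of_nonpos_of_nonneg h (by positivity)) (heatKernel_nonneg hs z))
    rw [← abs_of_pos (subordConst_pos hα0), ← abs_mul, ← integral_rpow_mul_gradKernel,
      abs_of_nonpos (setIntegral_nonpos measurableSet_Ioi fun s hs => hneg s hs),
      ← integral_neg]
    exact setIntegral_congr_fun measurableSet_Ioi fun s hs => Real.norm_of_nonpos (hneg s hs)

/-! ### Integrability of the Riesz kernel and smoothness of potentials. -/

theorem measurable_rieszKernel (α : ℝ) (i : Fin n) : Measurable (rieszKernel α i) := by
  unfold rieszKernel; fun_prop

theorem abs_rieszKernel_le (α : ℝ) (i : Fin n) {z : EuclideanSpace ℝ (Fin n)} (hz : z ≠ 0) :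
    |rieszKernel α i z| ≤ ‖z‖ ^ (-α) := by
  have hz0 : 0 < ‖z‖ := norm_pos_iff.2 hz
  have h1 : |z i| ≤ ‖z‖ := by simpa using PiLp.norm_apply_le z i
  rw [rieszKernel, abs_div, abs_of_pos (a := ‖z‖ ^ (1 + α)) (by positivity),
    div_le_iff₀ (by positivity), ← Real.rpow_add hz0]
  simpa using h1

theorem abs_rieszKernel_le_one {α : ℝ} (hα0 : 0 < α) (i : Fin n) {z : EuclideanSpace ℝ (Fin n)}
    (hz : 1 ≤ ‖z‖) : |rieszKernel α i z| ≤ 1 :=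
  (abs_rieszKernel_le α i (norm_pos_iff.1 (by linarith))).trans
    (Real.rpow_le_one_of_one_le_of_nonpos hz (by linarith))

theorem integrableOn_rieszKernel {α : ℝ} (hα0 : 0 < α) (hαn : α < n) (i : Fin n) :
    IntegrableOn (rieszKernel α i) (Metric.ball 0 1) := by
  have hn : 0 < n := by
    have := hα0.trans hαn
    exact_mod_cast this
  have : Nonempty (Fin n) := ⟨⟨0, hn⟩⟩
  have h : IntegrableOn (fun z : EuclideanSpace ℝ (Fin n) => ‖z‖ ^ (-α)) (Metric.ball 0 1) := by
    rw [integrableOn_fun_norm_addHaar volume (f := fun y : ℝ => y ^ (-α)),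
      finrank_euclideanSpace, Fintype.card_fin]
    have h2 : IntegrableOn (fun y : ℝ => y ^ ((n : ℝ) - 1 - α)) (Ioo 0 1) := by
      rw [intervalIntegral.integrableOn_Ioo_rpow_iff one_pos]
      linarith
    refine h2.congr_fun (fun y hy => ?_) measurableSet_Ioo
    simp only [smul_eq_mul]
    rw [← Real.rpow_natCast, ← Real.rpow_add hy.1]
    congr 1
    push_cast [Nat.cast_sub (show 1 ≤ n from hn)]; ring
  refine Integrable.mono' h (measurable_rieszKernel α i).aestronglyMeasurable
    (ae_restrict_of_ae ?_)
  have : ∀ᵐ z : EuclideanSpace ℝ (Fin n), z ≠ 0 := by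
    have : Nontrivial (EuclideanSpace ℝ (Fin n)) := inferInstance
    exact Measure.ae_ne volume 0
  filter_upwards [this] with z hz
  exact abs_rieszKernel_le α i hz

/-- A bounded integrable function is integrable against the Riesz kernel. -/
theorem exists_lintegral_rieszKernel_mul_le {α : ℝ} (hα0 : 0 < α) (hαn : α < n) (i : Fin n) :
    ∃ C : ℝ, 0 ≤ C ∧ ∀ (h : EuclideanSpace ℝ (Fin n) → ℝ) (M : ℝ), (∀ x, |h x| ≤ M) →
      ∫⁻ z, ‖rieszKernel α i z * h z‖ₑ ≤ ENNReal.ofReal (C * M) + ∫⁻ x, ‖h x‖ₑ := by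
  have hK := integrableOn_rieszKernel hα0 hαn i
  refine ⟨∫ z in Metric.ball 0 1, ‖rieszKernel α i z‖,
    integral_nonneg fun z => norm_nonneg _, fun h M hM => ?_⟩
  -- Inside the unit ball the kernel is integrable and `h` is bounded; outside it the kernel is at
  -- most `1` and `h` supplies the integrability.
  rw [← lintegral_add_compl _ (Metric.isOpen_ball (x := (0 : EuclideanSpace ℝ (Fin n)))
    (ε := 1)).measurableSet]
  refine add_le_add ?_ ?_
  · rw [← integral_mul_const, ofReal_integral_eq_lintegral_ofReal (hK.norm.mul_const M)
      (ae_of_all _ fun z => mul_nonneg (norm_nonneg _) ((abs_nonneg _).trans (hM z)))]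
    refine lintegral_mono fun z => ?_
    rw [← ofReal_norm, norm_mul]
    exact ENNReal.ofReal_le_ofReal (mul_le_mul_of_nonneg_left (hM z) (norm_nonneg _))
  · refine le_trans ?_ (setLIntegral_le_lintegral (Metric.ball 0 1)ᶜ _)
    refine setLIntegral_mono' Metric.isOpen_ball.measurableSet.compl fun z hz => ?_
    rw [enorm_mul]
    refine mul_le_of_le_one_left' ?_
    rw [← ofReal_norm, ENNReal.ofReal_le_one]
    refine abs_rieszKernel_le_one hα0 i ?_
    simpa using hz

theorem reflectedPotential_eq (α : ℝ) (i : Fin n) (h : EuclideanSpace ℝ (Fin n) → ℝ)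
    (y : EuclideanSpace ℝ (Fin n)) :
    reflectedPotential α i h y = ∫ z, rieszKernel α i z * h (y + z) := by
  rw [reflectedPotential, ← integral_add_right_eq_self _ y]
  simp [add_comm]

theorem integrable_rieszKernel_mul {α : ℝ} (hα0 : 0 < α) (hαn : α < n) (i : Fin n)
    {h : EuclideanSpace ℝ (Fin n) → ℝ} {M : ℝ} (hM : ∀ x, |h x| ≤ M) (hi : Integrable h)
    (y : EuclideanSpace ℝ (Fin n)) : Integrable fun z => rieszKernel α i z * h (y + z) := by
  obtain ⟨C, -, hC⟩ := exists_lintegral_rieszKernel_mul_le hα0 hαn i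
  have hi' : Integrable fun z => h (y + z) := hi.comp_add_left y
  refine ⟨(measurable_rieszKernel α i).aestronglyMeasurable.mul hi'.1,
    (hC (fun z => h (y + z)) M fun x => hM _).trans_lt ?_⟩
  exact ENNReal.add_lt_top.2 ⟨ENNReal.ofReal_lt_top, hi'.2⟩

theorem locallyIntegrable_rieszKernel {α : ℝ} (hα0 : 0 < α) (hαn : α < n) (i : Fin n) :
    LocallyIntegrable (rieszKernel α i) := by
  rw [locallyIntegrable_iff]
  intro k hk
  have h1 : Integrable (k.indicator fun _ => (1 : ℝ)) :=
    (integrable_indicator_iff hk.measurableSet).2 (integrableOn_const hk.measure_lt_top.ne)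
  have h2 := integrable_rieszKernel_mul hα0 hαn i (h := k.indicator fun _ => (1 : ℝ)) (M := 1)
    (fun x => by by_cases hx : x ∈ k <;> simp [hx]) h1 0
  rw [← integrable_indicator_iff hk.measurableSet]
  refine h2.congr (ae_of_all _ fun z => ?_)
  by_cases hx : z ∈ k <;> simp [hx]

theorem contDiff_reflectedPotential {α : ℝ} (hα0 : 0 < α) (hαn : α < n) (i : Fin n)
    (ψ : Test n) : ContDiff ℝ ∞ (reflectedPotential α i ψ) := by
  have hK : LocallyIntegrable fun z => rieszKernel α i (-z) := by
    have h := locallyIntegrable_rieszKernel hα0 hαn i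
    rw [locallyIntegrable_iff] at h ⊢
    intro k hk
    have h1 := h (-k) hk.neg
    rw [← integrable_indicator_iff hk.neg.measurableSet] at h1
    rw [← integrable_indicator_iff hk.measurableSet]
    refine h1.comp_neg.congr (ae_of_all _ fun z => ?_)
    by_cases hz : z ∈ k <;> simp [hz]
  have h := ψ.hasCompactSupport.contDiff_convolution_right (ContinuousLinearMap.mul ℝ ℝ)
    (n := ⊤) hK ψ.contDiff
  convert h using 1
  ext y
  rw [reflectedPotential_eq, ← integral_neg_eq_self]
  simp [convolution, sub_eq_add_neg]

/-! ### The inversion formula and its nonzero constant. -/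

/-- The heat flow has a default value at time `0`, so only the one-sided limit there is assumed and
`f` is redefined at `0` by it. -/
theorem integral_Ioi_eq_sub_of_tendsto {f f' : ℝ → ℝ} {l m : ℝ}
    (hderiv : ∀ x, 0 < x → HasDerivAt f (f' x) x) (f'int : IntegrableOn f' (Ioi 0))
    (h0 : Tendsto f (𝓝[>] 0) (𝓝 l)) (hm : Tendsto f atTop (𝓝 m)) :
    ∫ x in Ioi 0, f' x = m - l := by
  have h := integral_Ioi_of_hasDerivAt_of_tendsto (f := Function.update f 0 l) (f' := f') (a := 0)
    (m := m) ?_ (fun x (hx : 0 < x) => ?_) f'int ?_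
  · simpa using h
  · rw [continuousWithinAt_update_same]
    simpa using h0
  · refine (hderiv x hx).congr_of_eventuallyEq ?_
    filter_upwards [lt_mem_nhds hx] with y hy
    rw [Function.update_of_ne hy.ne']
  · refine hm.congr' ?_
    filter_upwards [eventually_gt_atTop 0] with y hy
    rw [Function.update_of_ne hy.ne']

/-- The change of variables `s = r t` on the quadrant. -/
theorem integrable_and_integral_comp_mul {F : ℝ × ℝ → ℝ} (hF : Measurable F)
    (hi : Integrable F ((volume.restrict (Ioi 0)).prod (volume.restrict (Ioi 0)))) :
    Integrable (fun p : ℝ × ℝ => p.1 * F (p.1, p.1 * p.2))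
        ((volume.restrict (Ioi 0)).prod (volume.restrict (Ioi 0))) ∧
      ∫ p, p.1 * F (p.1, p.1 * p.2) ∂((volume.restrict (Ioi 0)).prod (volume.restrict (Ioi 0)))
        = ∫ p, F p ∂((volume.restrict (Ioi 0)).prod (volume.restrict (Ioi 0))) := by
  have hm : AEStronglyMeasurable (fun p : ℝ × ℝ => p.1 * F (p.1, p.1 * p.2))
      ((volume.restrict (Ioi 0)).prod (volume.restrict (Ioi 0))) :=
    (Measurable.aestronglyMeasurable (by fun_prop))
  have hscale : ∀ g : ℝ → ℝ, ∀ r : ℝ, 0 < r → ∫ t in Ioi 0, r * g (r * t) = ∫ s in Ioi 0, g s := by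
    intro g r hr
    rw [integral_const_mul, integral_comp_mul_left_Ioi g 0 hr, mul_zero, smul_eq_mul,
      mul_inv_cancel_left₀ hr.ne']
  have hint : Integrable (fun p : ℝ × ℝ => p.1 * F (p.1, p.1 * p.2))
      ((volume.restrict (Ioi 0)).prod (volume.restrict (Ioi 0))) := by
    rw [integrable_prod_iff hm]
    obtain ⟨h1, h2⟩ := (integrable_prod_iff hi.1).1 hi
    constructor
    · filter_upwards [h1, ae_restrict_mem measurableSet_Ioi] with r hr (hr0 : 0 < r)
      refine Integrable.const_mul ?_ _
      exact (integrableOn_Ioi_comp_mul_left_iff (fun s => F (r, s)) 0 hr0).2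
        (by rw [mul_zero]; exact hr)
    · refine h2.congr ?_
      filter_upwards [ae_restrict_mem measurableSet_Ioi] with r (hr0 : 0 < r)
      rw [← hscale _ r hr0]
      simp_rw [norm_mul, Real.norm_of_nonneg hr0.le]
  refine ⟨hint, ?_⟩
  rw [integral_prod _ hint, integral_prod _ hi]
  refine integral_congr_ae ?_
  filter_upwards [ae_restrict_mem measurableSet_Ioi] with r (hr0 : 0 < r)
  exact hscale (fun s => F (r, s)) r hr0

/-- What matters is the constant sign `(-1) ^ m`: it prevents the integral in `rieszConst` from
vanishing. -/
theorem fwdDiff_iter_inv (m : ℕ) {x : ℝ} (hx : 0 < x) :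
    (fwdDiff 1)^[m] (fun u : ℝ => 1 / u) x
      = (-1) ^ m * m.factorial / ∏ k ∈ Finset.range (m + 1), (x + k) := by
  induction m generalizing x with
  | zero => simp
  | succ m ih =>
    rw [Function.iterate_succ_apply', fwdDiff, ih hx, ih (by linarith : 0 < x + 1)]
    have h1 : ∏ k ∈ Finset.range (m + 1 + 1), (x + k)
        = (∏ k ∈ Finset.range (m + 1), (x + k)) * (x + (m + 1)) := by
      rw [Finset.prod_range_succ]; push_cast; ring
    have h2 : ∏ k ∈ Finset.range (m + 1 + 1), (x + k)
        = (∏ k ∈ Finset.range (m + 1), (x + 1 + k)) * x := by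
      rw [Finset.prod_range_succ']
      simp only [Nat.cast_zero, add_zero]
      congr 1
      refine Finset.prod_congr rfl fun k _ => ?_
      push_cast; ring
    have p0 : 0 < ∏ k ∈ Finset.range (m + 1 + 1), (x + k) :=
      Finset.prod_pos fun k _ => by positivity
    have p1 : 0 < ∏ k ∈ Finset.range (m + 1), (x + k) :=
      Finset.prod_pos fun k _ => by positivity
    have p2 : 0 < ∏ k ∈ Finset.range (m + 1), (x + 1 + k) :=
      Finset.prod_pos fun k _ => by positivity
    have e1 : (∏ k ∈ Finset.range (m + 1), (x + k))
        = (∏ k ∈ Finset.range (m + 1 + 1), (x + k)) / (x + (m + 1)) := by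
      rw [h1]; field_simp
    have e2 : (∏ k ∈ Finset.range (m + 1), (x + 1 + k))
        = (∏ k ∈ Finset.range (m + 1 + 1), (x + k)) / x := by
      rw [h2]; field_simp
    rw [e1, e2, Nat.factorial_succ]
    push_cast
    field_simp
    ring

theorem sum_diffCoeff_div (t : ℝ) (ht : 0 < t) :
    ∑ k ∈ Finset.range (n + 1), diffCoeff n k / (t + (k + 1))
      = (-1) ^ n * n.factorial / ∏ k ∈ Finset.range (n + 1), (t + 1 + k) := by
  rw [← fwdDiff_iter_inv n (by linarith : 0 < t + 1), fwdDiff_iter_eq_sum_diffCoeff]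
  refine Finset.sum_congr rfl fun k _ => ?_
  rw [mul_one, mul_one_div]; congr 1; ring

theorem integrableOn_rpow_mul_prod_inv {α : ℝ} (hα0 : 0 < α) (hαn : α < n) :
    IntegrableOn (fun t : ℝ => t ^ (heatExp n α - 1)
      * (n.factorial / ∏ k ∈ Finset.range (n + 1), (t + 1 + k))) (Ioi 0) := by
  have hn : (0 : ℝ) ≤ n := by positivity
  have hbound : ∀ t : ℝ, 0 < t → (1 + t) ^ (n + 1) ≤ ∏ k ∈ Finset.range (n + 1), (t + 1 + k) := by
    intro t ht
    rw [← Finset.card_range (n + 1), ← Finset.prod_const, Finset.card_range]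
    refine Finset.prod_le_prod (fun k _ => by positivity) fun k _ => ?_
    have : (0 : ℝ) ≤ k := by positivity
    linarith
  have hm : Measurable fun t : ℝ => t ^ (heatExp n α - 1)
      * (n.factorial / ∏ k ∈ Finset.range (n + 1), (t + 1 + k)) := by fun_prop
  rw [← Ioc_union_Ioi_eq_Ioi zero_le_one]
  refine IntegrableOn.union ?_ ?_
  · have h : IntegrableOn (fun t : ℝ => t ^ (heatExp n α - 1) * n.factorial) (Ioc 0 1) := by
      refine Integrable.mul_const ?_ _
      change IntegrableOn (fun t : ℝ => t ^ (heatExp n α - 1)) (Ioc 0 1)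
      rw [← intervalIntegrable_iff_integrableOn_Ioc_of_le zero_le_one]
      refine intervalIntegral.intervalIntegrable_rpow' ?_
      unfold heatExp; linarith
    refine Integrable.mono' h hm.aestronglyMeasurable
      ((ae_restrict_iff' measurableSet_Ioc).2 (ae_of_all _ fun t ht => ?_))
    have h1 : (1 : ℝ) ≤ ∏ k ∈ Finset.range (n + 1), (t + 1 + k) :=
      (one_le_pow₀ (by linarith [ht.1])).trans (hbound t ht.1)
    have ht1 := ht.1
    rw [Real.norm_of_nonneg (by positivity)]
    exact mul_le_mul_of_nonneg_left (div_le_self (by positivity) h1) (by positivity)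
  · have h : IntegrableOn (fun t : ℝ => t ^ (heatExp n α - 1 - (n + 1)) * n.factorial) (Ioi 1) := by
      refine Integrable.mul_const ?_ _
      refine integrableOn_Ioi_rpow_of_lt ?_ one_pos
      unfold heatExp; linarith
    refine Integrable.mono' h hm.aestronglyMeasurable
      ((ae_restrict_iff' measurableSet_Ioi).2 (ae_of_all _ fun t (ht : 1 < t) => ?_))
    have ht0 : 0 < t := by linarith
    have h1 : t ^ (n + 1) ≤ ∏ k ∈ Finset.range (n + 1), (t + 1 + k) :=
      (pow_le_pow_left₀ ht0.le (by linarith) _).trans (hbound t ht0)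
    rw [Real.norm_of_nonneg (by positivity),
      Real.rpow_sub ht0 (heatExp n α - 1) (n + 1)]
    have h2 : t ^ ((n : ℝ) + 1) = t ^ (n + 1) := by
      rw [← Real.rpow_natCast]; push_cast; rfl
    rw [h2, div_mul_eq_mul_div, mul_div_assoc]
    exact mul_le_mul_of_nonneg_left (div_le_div_of_nonneg_left (by positivity) (by positivity) h1)
      (by positivity)

/-- The constant in the inversion formula for the vector valued Riesz transform. -/
def rieszConst (n : ℕ) (α : ℝ) : ℝ :=
  -((subordConst n α)⁻¹ * ∫ t in Ioi (0 : ℝ), t ^ (heatExp n α - 1)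
    * ∑ k ∈ Finset.range (n + 1), diffCoeff n k / (t + (k + 1)))

theorem rieszConst_ne_zero {α : ℝ} (hα0 : 0 < α) (hαn : α < n) : rieszConst n α ≠ 0 := by
  have h : ∫ t in Ioi (0 : ℝ), t ^ (heatExp n α - 1)
      * ∑ k ∈ Finset.range (n + 1), diffCoeff n k / (t + (k + 1))
      = (-1) ^ n * ∫ t in Ioi (0 : ℝ), t ^ (heatExp n α - 1)
      * (n.factorial / ∏ k ∈ Finset.range (n + 1), (t + 1 + k)) := by
    rw [← integral_const_mul]
    refine setIntegral_congr_fun measurableSet_Ioi fun t ht => ?_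
    rw [sum_diffCoeff_div t ht]; ring
  have hpos := setIntegral_Ioi_pos (fun t ht => ?_) (integrableOn_rpow_mul_prod_inv hα0 hαn)
  · rw [rieszConst, h]
    exact neg_ne_zero.2 (mul_ne_zero (inv_ne_zero (subordConst_pos hα0).ne')
      (mul_ne_zero (by simp) hpos.ne'))
  · have : 0 < ∏ k ∈ Finset.range (n + 1), (t + 1 + k) :=
      Finset.prod_pos fun k _ => by positivity
    positivity

/-- The integrand of the triple integral in the inversion formula. -/
def rieszIntegrand (α : ℝ) (i : Fin n) (φ : Test n) (y : EuclideanSpace ℝ (Fin n))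
    (p : (ℝ × ℝ) × EuclideanSpace ℝ (Fin n)) : ℝ :=
  (p.1.1 ^ (-heatExp n α) * heatDiff i φ p.1.1 (y + p.2))
    * (p.1.2 ^ (heatExp n α - 1) * gradKernel i p.1.2 p.2)

theorem measurable_rieszIntegrand (α : ℝ) (i : Fin n) (φ : Test n)
    (y : EuclideanSpace ℝ (Fin n)) : Measurable (rieszIntegrand α i φ y) := by
  unfold rieszIntegrand
  have h1 := (measurable_heatDiff i φ).comp
    (f := fun p : (ℝ × ℝ) × EuclideanSpace ℝ (Fin n) => (p.1.1, y + p.2)) (by fun_prop)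
  have h2 := (measurable_gradKernel i).comp
    (f := fun p : (ℝ × ℝ) × EuclideanSpace ℝ (Fin n) => (p.1.2, p.2)) (by fun_prop)
  simp only [Function.comp_def] at h1 h2
  fun_prop

/-- By Tonelli: the integral in `s` gives `|rieszKernel α i z|`, the integral in `z` is controlled
by the sup and `L¹` norms of `heatDiff`, and the integral in `r` converges because of `heatWeight`.
-/
theorem integrable_rieszIntegrand {α : ℝ} (hα0 : 0 < α) (hαn : α < n) (i : Fin n) (φ : Test n)
    (y : EuclideanSpace ℝ (Fin n)) :
    Integrable (rieszIntegrand α i φ y)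
      (((volume.restrict (Ioi 0)).prod (volume.restrict (Ioi 0))).prod volume) := by
  have hm := measurable_rieszIntegrand α i φ y
  refine ⟨hm.aestronglyMeasurable, ?_⟩
  obtain ⟨C, hC0, hC⟩ := exists_lintegral_rieszKernel_mul_le hα0 hαn i
  obtain ⟨D, hD0, hD⟩ := exists_abs_heatDiff_le i φ
  have hmh : ∀ r, Measurable fun x => heatDiff i φ r x := fun r =>
    (measurable_heatDiff i φ).comp (f := fun x => (r, x)) (by fun_prop)
  calc ∫⁻ p, ‖rieszIntegrand α i φ y p‖ₑ
        ∂(((volume.restrict (Ioi 0)).prod (volume.restrict (Ioi 0))).prod volume)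
      = ∫⁻ r in Ioi (0 : ℝ), ∫⁻ z, ∫⁻ s in Ioi (0 : ℝ),
        ‖rieszIntegrand α i φ y ((r, s), z)‖ₑ := by
        rw [lintegral_prod _ hm.enorm.aemeasurable, lintegral_prod _ (by
          exact Measurable.aemeasurable hm.enorm.lintegral_prod_right)]
        refine lintegral_congr fun r => ?_
        refine lintegral_lintegral_swap (Measurable.aemeasurable ?_)
        exact (hm.comp (f := fun q : ℝ × EuclideanSpace ℝ (Fin n) => ((r, q.1), q.2))
          (by fun_prop)).enorm
    _ = ∫⁻ r in Ioi (0 : ℝ), ENNReal.ofReal (subordConst n α) * ∫⁻ z, ‖rieszKernel α i z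
          * (r ^ (-heatExp n α) * heatDiff i φ r (y + z))‖ₑ := by
        refine lintegral_congr fun r => ?_
        rw [← lintegral_const_mul _ (by
          have h1 := (hmh r).comp (f := fun z => y + z) (by fun_prop)
          have h2 := measurable_rieszKernel α i
          exact Measurable.enorm (h2.mul (h1.const_mul _)))]
        refine lintegral_congr fun z => ?_
        simp_rw [rieszIntegrand, enorm_mul _ (_ * gradKernel _ _ _)]
        rw [lintegral_const_mul _ (by
          have h2 := (measurable_gradKernel i).comp
            (f := fun s : ℝ => (s, z)) (by fun_prop)
          simp only [Function.comp_def] at h2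
          exact Measurable.enorm (by fun_prop)), lintegral_enorm_rpow_mul_gradKernel hα0,
          enorm_mul (rieszKernel α i z)]
        ring
    _ ≤ ∫⁻ r in Ioi (0 : ℝ), ENNReal.ofReal (subordConst n α) *
          (ENNReal.ofReal (C * (r ^ (-heatExp n α) * heatWeight n r * D))
            + ∫⁻ x, ‖r ^ (-heatExp n α) * heatDiff i φ r x‖ₑ) := by
        refine setLIntegral_mono' measurableSet_Ioi fun r (hr : 0 < r) => ?_
        refine mul_le_mul_right ?_ _
        have hb : ∀ x, |r ^ (-heatExp n α) * heatDiff i φ r x|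
            ≤ r ^ (-heatExp n α) * heatWeight n r * D := by
          intro x
          rw [abs_mul, abs_of_pos (by positivity : 0 < r ^ (-heatExp n α)), mul_assoc]
          exact mul_le_mul_of_nonneg_left (hD r hr x) (by positivity)
        refine (hC (fun z => r ^ (-heatExp n α) * heatDiff i φ r (y + z)) _
          fun x => hb _).trans_eq ?_
        rw [lintegral_add_left_eq_self (fun x => ‖r ^ (-heatExp n α) * heatDiff i φ r x‖ₑ) y]
    _ < ⊤ := by
        have hw := measurable_heatWeight (n := n)
        have hm1 : Measurable fun r : ℝ =>
            ENNReal.ofReal (C * (r ^ (-heatExp n α) * heatWeight n r * D)) := by fun_prop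
        rw [lintegral_const_mul'  _ _ ENNReal.ofReal_ne_top, lintegral_add_left hm1]
        refine ENNReal.mul_lt_top ENNReal.ofReal_lt_top (ENNReal.add_lt_top.2 ⟨?_, ?_⟩)
        · have := (((integrableOn_rpow_mul_heatWeight hα0 hαn).mul_const D).const_mul C).2
          refine lt_of_le_of_lt (lintegral_mono fun r => ?_) this
          exact Real.ofReal_le_enorm _
        · refine (lintegral_lintegral_heatDiff_le hα0 hαn i φ).trans_lt ?_
          exact ENNReal.mul_lt_top ENNReal.ofReal_lt_top
            (ENNReal.add_lt_top.2 ⟨Test.lintegral_enorm_lt_top _,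
              ENNReal.mul_lt_top ENNReal.ofReal_lt_top φ.lintegral_enorm_lt_top⟩)

theorem reflectedPotential_rieszInverse {α : ℝ} (hα0 : 0 < α) (hαn : α < n) (i : Fin n)
    (φ : Test n) (y : EuclideanSpace ℝ (Fin n)) :
    reflectedPotential α i (rieszInverse α i φ) y
      = (subordConst n α)⁻¹ * ∫ p : ℝ × ℝ, (∫ z, rieszIntegrand α i φ y (p, z))
        ∂((volume.restrict (Ioi 0)).prod (volume.restrict (Ioi 0))) := by
  have hi := integrable_rieszIntegrand hα0 hαn i φ y
  rw [← integral_prod _ hi, integral_prod_symm _ hi, reflectedPotential_eq, ← integral_const_mul]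
  congr 1; ext z
  simp only [rieszIntegrand]
  rw [integral_prod_mul (fun r : ℝ => r ^ (-heatExp n α) * heatDiff i φ r (y + z))
    (fun s : ℝ => s ^ (heatExp n α - 1) * gradKernel i s z), integral_rpow_mul_gradKernel,
    rieszInverse]
  have := (subordConst_pos (n := n) hα0).ne'
  field_simp

/-- Integration against `gradKernel i s` is `∂ᵢ` followed by the flow for time `s`, and the flow
times add up. -/
theorem integral_gradKernel_mul_heatFlow (i : Fin n) {s u : ℝ} (hs : 0 < s) (hu : 0 < u)
    (φ : Test n) (y : EuclideanSpace ℝ (Fin n)) :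
    ∫ z, gradKernel i s z * heatFlow u (partialDeriv i φ) (y + z)
      = heatFlow (s + u) (partialDeriv i (partialDeriv i φ)) y := by
  rw [add_comm s u, ← heatFlow_heatFlow hu hs]
  have h1 : ∀ x, heatFlow s (partialDeriv i (partialDeriv i φ)) (y + x)
      = ∫ z, gradKernel i s z * partialDeriv i φ (y + x + z) :=
    fun x => heatFlow_partialDeriv i hs _ _
  rw [heatFlow]
  simp_rw [h1, heatFlow, ← integral_const_mul]
  obtain ⟨D, -, hD⟩ := (partialDeriv i φ).exists_bound
  have hint : Integrable (Function.uncurry fun z x : EuclideanSpace ℝ (Fin n) =>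
      gradKernel i s z * (heatKernel u x * partialDeriv i φ (y + z + x))) := by
    have h2 := ((integrable_gradKernel i hs).mul_prod (integrable_heatKernel hu)).mul_bdd (c := D)
      (g := fun p : EuclideanSpace ℝ (Fin n) × EuclideanSpace ℝ (Fin n) =>
        partialDeriv i φ (y + p.1 + p.2))
      ((partialDeriv i φ).continuous.comp (by fun_prop)).aestronglyMeasurable
      (ae_of_all _ fun z => hD _)
    exact h2.congr (ae_of_all _ fun p => by simp [Function.uncurry, mul_assoc])
  rw [integral_integral_swap hint]
  congr 1; ext x
  congr 1; ext z
  rw [add_right_comm y z x]; ring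

theorem sum_integral_rieszIntegrand (α : ℝ) (φ : Test n) (y : EuclideanSpace ℝ (Fin n))
    {r s : ℝ} (hr : 0 < r) (hs : 0 < s) :
    ∑ i, ∫ z, rieszIntegrand α i φ y ((r, s), z)
      = r ^ (-heatExp n α) * (s ^ (heatExp n α - 1) * ∑ k ∈ Finset.range (n + 1),
        diffCoeff n k * heatFlow (s + (k + 1) * r) (laplace φ) y) := by
  have hk : ∀ k : ℕ, 0 < (k + 1 : ℝ) * r := fun k => by positivity
  have hint : ∀ i, ∀ k : ℕ, Integrable fun z =>
      gradKernel i s z * heatFlow ((k + 1) * r) (partialDeriv i φ) (y + z) := by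
    intro i k
    obtain ⟨D, -, hD⟩ := (partialDeriv i φ).exists_bound
    refine (integrable_gradKernel i hs).mul_bdd (c := D)
      (((measurable_heatFlow (partialDeriv i φ)).comp
        (f := fun z => (((k + 1) * r : ℝ), y + z)) (by fun_prop)).aestronglyMeasurable)
      (ae_of_all _ fun z => abs_heatFlow_le hD (hk k) _)
  have h1 : ∀ i, ∫ z, rieszIntegrand α i φ y ((r, s), z)
      = r ^ (-heatExp n α) * (s ^ (heatExp n α - 1) * ∑ k ∈ Finset.range (n + 1),
        diffCoeff n k * heatFlow (s + (k + 1) * r) (partialDeriv i (partialDeriv i φ)) y) := by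
    intro i
    have : ∀ z, rieszIntegrand α i φ y ((r, s), z)
        = (r ^ (-heatExp n α) * s ^ (heatExp n α - 1)) * ∑ k ∈ Finset.range (n + 1), diffCoeff n k *
          (gradKernel i s z * heatFlow ((k + 1) * r) (partialDeriv i φ) (y + z)) := by
      intro z
      simp only [rieszIntegrand, heatDiff, Finset.mul_sum, Finset.sum_mul]
      refine Finset.sum_congr rfl fun k _ => ?_
      ring
    simp_rw [this]
    rw [integral_const_mul, integral_finsetSum _ fun k _ => (hint i k).const_mul _, mul_assoc]
    simp_rw [integral_const_mul, integral_gradKernel_mul_heatFlow i hs (hk _)]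
  simp_rw [h1, ← Finset.mul_sum]
  congr 2
  rw [Finset.sum_comm]
  refine Finset.sum_congr rfl fun k _ => ?_
  rw [← Finset.mul_sum]
  congr 1
  have hu : 0 < s + (k + 1) * r := by have := hk k; linarith
  simp only [heatFlow, laplace_apply, Finset.mul_sum]
  rw [integral_finsetSum _ fun i _ => integrable_mul_test (integrable_heatKernel hu) _ y]

theorem integral_sum_heatFlow_laplace (hn : n ≠ 0) (φ : Test n) (y : EuclideanSpace ℝ (Fin n))
    {t : ℝ} (ht : 0 < t) (hi : IntegrableOn (fun r => ∑ k ∈ Finset.range (n + 1),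
      diffCoeff n k * heatFlow (r * t + (k + 1) * r) (laplace φ) y) (Ioi 0)) :
    ∫ r in Ioi (0 : ℝ), ∑ k ∈ Finset.range (n + 1),
      diffCoeff n k * heatFlow (r * t + (k + 1) * r) (laplace φ) y
      = -(φ y * ∑ k ∈ Finset.range (n + 1), diffCoeff n k / (t + (k + 1))) := by
  have hpos : ∀ k : ℕ, 0 < t + (k + 1 : ℝ) := fun k => by positivity
  -- By the heat equation each term is the derivative in `r` of the flow of `φ` at time `r * (t + (k
  -- + 1))`, divided by `t + (k + 1)`. The primitive vanishes at infinity and the flow tends to `φ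
  -- y` at `0`.
  rw [integral_Ioi_eq_sub_of_tendsto (f := fun r => ∑ k ∈ Finset.range (n + 1),
    diffCoeff n k / (t + (k + 1)) * heatFlow (r * (t + (k + 1))) φ y)
    (l := ∑ k ∈ Finset.range (n + 1), diffCoeff n k / (t + (k + 1)) * φ y) (m := 0) _ hi]
  · rw [zero_sub, ← Finset.sum_mul, mul_comm]
  · refine tendsto_finsetSum _ fun k _ => Tendsto.const_mul _ ?_
    refine (tendsto_heatFlow_nhdsGT φ y).comp ?_
    refine tendsto_nhdsWithin_iff.2 ⟨?_, ?_⟩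
    · have : Continuous fun r : ℝ => r * (t + (k + 1)) := by fun_prop
      have h := this.tendsto 0
      rw [zero_mul] at h
      exact h.mono_left nhdsWithin_le_nhds
    · filter_upwards [self_mem_nhdsWithin] with r hr
      exact mul_pos hr (hpos k)
  · have : (0 : ℝ) = ∑ k ∈ Finset.range (n + 1), diffCoeff n k / (t + (k + 1)) * 0 := by simp
    rw [this]
    refine tendsto_finsetSum _ fun k _ => Tendsto.const_mul _ ?_
    exact (tendsto_heatFlow_atTop hn φ y).comp (tendsto_id.atTop_mul_const (hpos k))
  · intro r hr
    refine HasDerivAt.fun_sum fun k _ => ?_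
    have h1 := (hasDerivAt_heatFlow φ y (mul_pos hr (hpos k))).comp r
      ((hasDerivAt_id r).mul_const (t + (k + 1 : ℝ)))
    refine (h1.const_mul (diffCoeff n k / (t + (k + 1)))).congr_deriv ?_
    rw [show r * (t + (k + 1 : ℝ)) = r * t + (k + 1) * r by ring]
    have := (hpos k).ne'
    field_simp

/-- The inversion formula for the vector valued Riesz transform. -/
theorem sum_reflectedPotential_rieszInverse {α : ℝ} (hα0 : 0 < α) (hαn : α < n) (φ : Test n)
    (y : EuclideanSpace ℝ (Fin n)) :
    ∑ i, reflectedPotential α i (rieszInverse α i φ) y = rieszConst n α * φ y := by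
  have hn : n ≠ 0 := by
    rintro rfl
    simp only [Nat.cast_zero] at hαn
    linarith
  set ν : Measure ℝ := volume.restrict (Ioi 0) with hν
  set F : ℝ × ℝ → ℝ := fun p => ∑ i, ∫ z, rieszIntegrand α i φ y (p, z) with hF
  have hFi : ∀ i, Integrable (fun p : ℝ × ℝ => ∫ z, rieszIntegrand α i φ y (p, z)) (ν.prod ν) :=
    fun i => (integrable_rieszIntegrand hα0 hαn i φ y).integral_prod_left
  have hFint : Integrable F (ν.prod ν) := integrable_finsetSum _ fun i _ => hFi i
  have hFm : Measurable F := by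
    refine Finset.measurable_sum _ fun i _ => ?_
    exact (measurable_rieszIntegrand α i φ y).stronglyMeasurable.integral_prod_right'.measurable
  obtain ⟨hG, hGF⟩ := integrable_and_integral_comp_mul hFm hFint
  have h1 : ∑ i, reflectedPotential α i (rieszInverse α i φ) y
      = (subordConst n α)⁻¹ * ∫ p, F p ∂(ν.prod ν) := by
    simp_rw [reflectedPotential_rieszInverse hα0 hαn, ← Finset.mul_sum]
    rw [integral_finsetSum _ fun i _ => hFi i]
  -- After the substitution `s = r * t` the powers of `r` cancel with the Jacobian, so the integral
  -- in `r` is that of an exact derivative.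
  have hGeq : ∀ r t : ℝ, 0 < r → 0 < t → r * F (r, r * t) = t ^ (heatExp n α - 1)
      * ∑ k ∈ Finset.range (n + 1),
        diffCoeff n k * heatFlow (r * t + (k + 1) * r) (laplace φ) y := by
    intro r t hr ht
    rw [hF]
    simp only
    rw [sum_integral_rieszIntegrand α φ y hr (mul_pos hr ht), Real.mul_rpow hr.le ht.le]
    have : r * (r ^ (-heatExp n α) * r ^ (heatExp n α - 1)) = 1 := by
      rw [← Real.rpow_add hr, show -heatExp n α + (heatExp n α - 1) = -1 by ring,
        Real.rpow_neg_one, mul_inv_cancel₀ hr.ne']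
    linear_combination (t ^ (heatExp n α - 1) * ∑ k ∈ Finset.range (n + 1),
        diffCoeff n k * heatFlow (r * t + (k + 1) * r) (laplace φ) y) * this
  rw [h1, ← hGF, integral_prod_symm _ hG, rieszConst]
  have h2 : ∫ t, ∫ r, r * F (r, r * t) ∂ν ∂ν = ∫ t in Ioi (0 : ℝ),
      -φ y * (t ^ (heatExp n α - 1)
        * ∑ k ∈ Finset.range (n + 1), diffCoeff n k / (t + (k + 1))) := by
    refine integral_congr_ae ?_
    -- Fubini supplies integrability in `r` for almost every `t`, which suffices for the fundamental
    -- theorem of calculus.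
    filter_upwards [hG.prod_left_ae, ae_restrict_mem measurableSet_Ioi] with t hti (ht : 0 < t)
    have hcongr : EqOn (fun r => r * F (r, r * t)) (fun r => t ^ (heatExp n α - 1)
        * ∑ k ∈ Finset.range (n + 1),
          diffCoeff n k * heatFlow (r * t + (k + 1) * r) (laplace φ) y) (Ioi 0) :=
      fun r hr => hGeq r t hr ht
    have hti' : IntegrableOn (fun r => ∑ k ∈ Finset.range (n + 1),
          diffCoeff n k * heatFlow (r * t + (k + 1) * r) (laplace φ) y) (Ioi 0) := by
      have h3 : IntegrableOn (fun r => r * F (r, r * t)) (Ioi 0) := hti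
      have h4 := (h3.congr_fun hcongr measurableSet_Ioi).const_mul (t ^ (heatExp n α - 1))⁻¹
      refine h4.congr (ae_of_all _ fun r => ?_)
      simp only
      rw [inv_mul_cancel_left₀ (by positivity)]
    rw [hν, setIntegral_congr_fun measurableSet_Ioi hcongr, integral_const_mul,
      integral_sum_heatFlow_laplace hn φ y ht hti']
    ring
  simp only at h2 ⊢
  rw [h2, integral_const_mul]
  ring

/-! ### Distributions of finite order. -/

section order

theorem smulTest_apply (ρ : EuclideanSpace ℝ (Fin n) → ℝ) (hρ : ContDiff ℝ ∞ ρ) (u : Test n)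
    (x : EuclideanSpace ℝ (Fin n)) : smulTest ρ hρ u x = ρ x * u x := rfl

/-- A distribution is of finite order on each compact set. -/
theorem exists_order (T : Dist n) (K : TopologicalSpace.Compacts (EuclideanSpace ℝ (Fin n))) :
    ∃ (N : ℕ) (C : ℝ), 0 ≤ C ∧ ∀ (ψ : Test n) (M : ℝ), 0 ≤ M → tsupport ψ ⊆ K →
      (∀ k ≤ N, ∀ x, ‖iteratedFDeriv ℝ k ψ x‖ ≤ M) → |T ψ| ≤ C * M := by
  have hsub : (K : Set (EuclideanSpace ℝ (Fin n)))
      ⊆ (⊤ : TopologicalSpace.Opens (EuclideanSpace ℝ (Fin n))) := fun _ _ => trivial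
  let L : 𝓓^{⊤}_{K}(EuclideanSpace ℝ (Fin n), ℝ) →ₗ[ℝ] ℝ :=
    { toFun := fun f => T (TestFunction.ofSupportedIn hsub f)
      map_add' := fun f g => map_add T (TestFunction.ofSupportedIn hsub f)
        (TestFunction.ofSupportedIn hsub g)
      map_smul' := fun c f => map_smul T c (TestFunction.ofSupportedIn hsub f) }
  have hL : Continuous L :=
    (map_continuous T).comp (TestFunction.continuous_ofSupportedIn hsub)
  let q : Seminorm ℝ 𝓓^{⊤}_{K}(EuclideanSpace ℝ (Fin n), ℝ) := (normSeminorm ℝ ℝ).comp L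
  have hq : Continuous q := continuous_norm.comp hL
  -- On functions supported in `K` the topology is given by the derivative seminorms, so the
  -- continuous seminorm `|T ·|` is controlled by finitely many of them; the largest index is the
  -- order.
  obtain ⟨s, C, -, hC⟩ := Seminorm.bound_of_continuous
    (ContDiffMapSupportedIn.withSeminorms ℝ (EuclideanSpace ℝ (Fin n)) ℝ ⊤ K) q hq
  refine ⟨s.sup id, C, C.2, fun ψ M hM hψ hb => ?_⟩
  let ψK : 𝓓^{⊤}_{K}(EuclideanSpace ℝ (Fin n), ℝ) :=
    ContDiffMapSupportedIn.of_support_subset ψ.contDiff ((subset_tsupport _).trans hψ)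
  have h1 : |T ψ| ≤ C * (s.sup (ContDiffMapSupportedIn.seminorm ℝ
      (EuclideanSpace ℝ (Fin n)) ℝ ⊤ K)) ψK := hC ψK
  refine h1.trans (mul_le_mul_of_nonneg_left ?_ C.2)
  refine Seminorm.finset_sup_apply_le hM fun k hk => ?_
  rw [ContDiffMapSupportedIn.seminorm_top_le_iff ℝ hM]
  exact fun x _ => hb k (Finset.le_sup (f := id) hk) x

theorem exists_bound_iteratedFDeriv (χ : Test n) (k : ℕ) :
    ∃ C, 0 ≤ C ∧ ∀ x, ‖iteratedFDeriv ℝ k χ x‖ ≤ C := by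
  obtain ⟨C, hC⟩ := (χ.hasCompactSupport.iteratedFDeriv (𝕜 := ℝ) k).exists_bound_of_continuous
    (χ.contDiff.continuous_iteratedFDeriv (by exact_mod_cast le_top))
  exact ⟨C, (norm_nonneg _).trans (hC 0), hC⟩

/-- By the Leibniz rule only the derivatives of `F` on the support of `χ` count. Thus `F` need not
be small, or compactly supported, anywhere else. -/
theorem exists_bound_smulTest (T : Dist n) (χ : Test n) :
    ∃ (N : ℕ) (C : ℝ), 0 ≤ C ∧ ∀ (F : EuclideanSpace ℝ (Fin n) → ℝ) (hF : ContDiff ℝ ∞ F) (M : ℝ),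
      0 ≤ M → (∀ k ≤ N, ∀ x ∈ tsupport χ, ‖iteratedFDeriv ℝ k F x‖ ≤ M) →
        |T (smulTest F hF χ)| ≤ C * M := by
  obtain ⟨N, C, hC0, hC⟩ := exists_order T ⟨tsupport χ, χ.hasCompactSupport⟩
  choose B hB0 hB using exists_bound_iteratedFDeriv χ
  set D : ℝ := ∑ k ∈ Finset.range (N + 1), ∑ i ∈ Finset.range (k + 1),
    (k.choose i : ℝ) * B (k - i) with hD
  have hDn : ∀ k, 0 ≤ ∑ i ∈ Finset.range (k + 1), (k.choose i : ℝ) * B (k - i) := fun k =>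
    Finset.sum_nonneg fun i _ => mul_nonneg (by positivity) (hB0 _)
  have hD0 : 0 ≤ D := Finset.sum_nonneg fun k _ => hDn k
  refine ⟨N, C * D, mul_nonneg hC0 hD0, fun F hF M hM hb => ?_⟩
  rw [mul_assoc]
  refine hC _ _ (mul_nonneg hD0 hM) (tsupport_mul_subset_right (f := F) (g := χ))
    fun k hk x => ?_
  have h1 : ‖iteratedFDeriv ℝ k (smulTest F hF χ) x‖ ≤ ∑ i ∈ Finset.range (k + 1),
      (k.choose i : ℝ) * ‖iteratedFDeriv ℝ i F x‖ * ‖iteratedFDeriv ℝ (k - i) χ x‖ :=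
    norm_iteratedFDeriv_mul_le (N := ∞) hF χ.contDiff x (by exact_mod_cast le_top)
  refine h1.trans ?_
  have h2 : ∑ i ∈ Finset.range (k + 1),
      (k.choose i : ℝ) * ‖iteratedFDeriv ℝ i F x‖ * ‖iteratedFDeriv ℝ (k - i) χ x‖
      ≤ (∑ i ∈ Finset.range (k + 1), (k.choose i : ℝ) * B (k - i)) * M := by
    rw [Finset.sum_mul]
    refine Finset.sum_le_sum fun i hi => ?_
    by_cases hx : x ∈ tsupport χ
    · have hi' : i ≤ N := (Nat.lt_succ_iff.1 (Finset.mem_range.1 hi)).trans hk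
      have e1 := hb i hi' x hx
      have e2 := hB (k - i) x
      calc _ ≤ (k.choose i : ℝ) * M * B (k - i) := by gcongr
        _ = _ := by ring
    · have : iteratedFDeriv ℝ (k - i) χ x = 0 := by
        by_contra hne
        exact hx (support_iteratedFDeriv_subset (k - i) (Function.mem_support.2 hne))
      rw [this, norm_zero, mul_zero]
      exact mul_nonneg (mul_nonneg (by positivity) (hB0 _)) hM
  refine h2.trans (mul_le_mul_of_nonneg_right ?_ hM)
  exact Finset.single_le_sum (f := fun k => ∑ i ∈ Finset.range (k + 1),
    (k.choose i : ℝ) * B (k - i)) (fun k _ => hDn k) (Finset.mem_range.2 (by omega))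

end order

/-! ### Mollification and its interaction with Riesz potentials. -/

section mollify

/-- The target `G` is arbitrary because the induction passes from `g` to `fderiv ℝ g`, whose values
are linear maps. -/
theorem iteratedFDeriv_convolution_right {G : Type} [NormedAddCommGroup G] [NormedSpace ℝ G]
    {f : EuclideanSpace ℝ (Fin n) → ℝ} {g : EuclideanSpace ℝ (Fin n) → G}
    (hf : LocallyIntegrable f) (hg : ContDiff ℝ ∞ g) (hcg : HasCompactSupport g) (k : ℕ)
    (x : EuclideanSpace ℝ (Fin n)) :
    iteratedFDeriv ℝ k (fun x => ∫ t, f t • g (x - t)) x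
      = ∫ t, f t • iteratedFDeriv ℝ k g (x - t) := by
  induction k generalizing G x with
  | zero =>
    simp only [iteratedFDeriv_zero_eq_comp, Function.comp_apply]
    have h := ContinuousLinearEquiv.integral_comp_comm (μ := volume) (continuousMultilinearCurryFin0 ℝ
      (EuclideanSpace ℝ (Fin n)) G).symm.toContinuousLinearEquiv fun t => f t • g (x - t)
    simp only [map_smul] at h
    exact h.symm
  | succ k ih =>
    have hfd : fderiv ℝ (fun x => ∫ t, f t • g (x - t)) = fun x => ∫ t, f t • fderiv ℝ g (x - t) := by
      ext1 x
      have := hcg.hasFDerivAt_convolution_right (ContinuousLinearMap.lsmul ℝ ℝ) hf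
        (hg.of_le (by simp)) x
      exact this.fderiv
    rw [iteratedFDeriv_succ_eq_comp_right, Function.comp_apply, hfd,
      ih (hg.fderiv_right (by simp)) (hcg.fderiv ℝ)]
    have h := ContinuousLinearEquiv.integral_comp_comm (μ := volume)
      (continuousMultilinearCurryRightEquiv' ℝ k (EuclideanSpace ℝ (Fin n))
        G).symm.toContinuousLinearEquiv fun t => f t • iteratedFDeriv ℝ k (fderiv ℝ g) (x - t)
    simp only [map_smul] at h
    simp only [iteratedFDeriv_succ_eq_comp_right, Function.comp_apply]
    exact h.symm

/-- The convolution of `h` with `ρ`. -/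
def mollify (ρ h : EuclideanSpace ℝ (Fin n) → ℝ) (x : EuclideanSpace ℝ (Fin n)) : ℝ :=
  ∫ t, ρ t * h (x - t)

theorem mollify_comm (ρ h : EuclideanSpace ℝ (Fin n) → ℝ) (x : EuclideanSpace ℝ (Fin n)) :
    mollify ρ h x = mollify h ρ x := by
  rw [mollify, mollify, ← integral_sub_left_eq_self _ volume x]
  congr 1; ext t
  rw [sub_sub_cancel, mul_comm]

theorem contDiff_mollify (ρ : Test n) {h : EuclideanSpace ℝ (Fin n) → ℝ}
    (hh : LocallyIntegrable h) : ContDiff ℝ ∞ (mollify ρ h) := by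
  have := ρ.hasCompactSupport.contDiff_convolution_right (ContinuousLinearMap.lsmul ℝ ℝ)
    (n := ⊤) hh ρ.contDiff
  convert this using 1
  ext x
  rw [mollify_comm]
  rfl

/-- The mollification of a compactly supported function, as a test function. -/
def mollifyTest (ρ : Test n) (h : EuclideanSpace ℝ (Fin n) → ℝ) (hh : LocallyIntegrable h)
    (hc : HasCompactSupport h) : Test n where
  toFun := mollify ρ h
  contDiff' := contDiff_mollify ρ hh
  hasCompactSupport' := ρ.hasCompactSupport.convolution (ContinuousLinearMap.lsmul ℝ ℝ) hc
  tsupport_subset' := by simp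

theorem locallyIntegrable_of_bounded {h : EuclideanSpace ℝ (Fin n) → ℝ} (hm : Measurable h) {M : ℝ}
    (hM : ∀ x, |h x| ≤ M) : LocallyIntegrable h :=
  (locallyIntegrable_const M).mono hm.aestronglyMeasurable
    (ae_of_all _ fun x => (hM x).trans (le_abs_self M))

theorem integral_abs_mollify_le {ρ h : EuclideanSpace ℝ (Fin n) → ℝ} (hρm : Measurable ρ)
    (hρ0 : ∀ x, 0 ≤ ρ x) (hρi : Integrable ρ) (hρ1 : ∫ x, ρ x = 1) (hm : Measurable h)
    (hi : Integrable h) : ∫ x, |mollify ρ h x| ≤ ∫ x, |h x| := by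
  have h1 : ∀ x, mollify ρ h x = ∫ z, ρ (-z) * h (x + z) := by
    intro x
    rw [mollify, ← integral_neg_eq_self]
    simp [sub_eq_add_neg]
  have h2 := lintegral_enorm_integral_mul_le (k := fun z => ρ (-z)) (by fun_prop) hm
  simp_rw [← h1] at h2
  rw [← ofReal_integral_norm_eq_lintegral_enorm hρi.comp_neg,
    integral_neg_eq_self (fun z => ‖ρ z‖)] at h2
  simp_rw [Real.norm_of_nonneg (hρ0 _)] at h2
  rw [hρ1, ENNReal.ofReal_one, one_mul] at h2
  have hmm : AEStronglyMeasurable (mollify ρ h) := by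
    have : StronglyMeasurable fun p : EuclideanSpace ℝ (Fin n) × EuclideanSpace ℝ (Fin n) =>
        ρ p.2 * h (p.1 - p.2) := Measurable.stronglyMeasurable (by fun_prop)
    exact this.integral_prod_right.aestronglyMeasurable
  have h3 : ∀ g : EuclideanSpace ℝ (Fin n) → ℝ, AEStronglyMeasurable g →
      ∫ x, |g x| = (∫⁻ x, ‖g x‖ₑ).toReal := fun g hg => integral_norm_eq_lintegral_enorm hg
  rw [h3 _ hmm, h3 _ hi.1]
  exact ENNReal.toReal_mono hi.2.ne h2

theorem measurable_reflectedPotential (α : ℝ) (i : Fin n) {h : EuclideanSpace ℝ (Fin n) → ℝ}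
    (hm : Measurable h) : Measurable (reflectedPotential α i h) := by
  have hK := measurable_rieszKernel α i
  have : StronglyMeasurable fun p : EuclideanSpace ℝ (Fin n) × EuclideanSpace ℝ (Fin n) =>
      rieszKernel α i (p.2 - p.1) * h p.2 := Measurable.stronglyMeasurable (by fun_prop)
  exact this.integral_prod_right.measurable

theorem exists_integral_abs_rieszKernel_mul_le {α : ℝ} (hα0 : 0 < α) (hαn : α < n) (i : Fin n)
    {h : EuclideanSpace ℝ (Fin n) → ℝ} {M : ℝ} (hM : ∀ x, |h x| ≤ M) (hi : Integrable h) :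
    ∃ C : ℝ, 0 ≤ C ∧ ∀ y, ∫ z, |rieszKernel α i z * h (y + z)| ≤ C := by
  obtain ⟨C, hC0, hC⟩ := exists_lintegral_rieszKernel_mul_le hα0 hαn i
  refine ⟨(ENNReal.ofReal (C * M) + ∫⁻ x, ‖h x‖ₑ).toReal, ENNReal.toReal_nonneg, fun y => ?_⟩
  have h1 := integrable_rieszKernel_mul hα0 hαn i hM hi y
  have h2 : ∫ z, |rieszKernel α i z * h (y + z)| = _ := integral_norm_eq_lintegral_enorm h1.1
  rw [h2]
  refine ENNReal.toReal_mono (ENNReal.add_ne_top.2 ⟨ENNReal.ofReal_ne_top, hi.2.ne⟩) ?_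
  have h3 := hC (fun z => h (y + z)) M fun x => hM _
  rwa [lintegral_add_left_eq_self (fun x => ‖h x‖ₑ) y] at h3

theorem exists_abs_reflectedPotential_le {α : ℝ} (hα0 : 0 < α) (hαn : α < n) (i : Fin n)
    {h : EuclideanSpace ℝ (Fin n) → ℝ} {M : ℝ} (hM : ∀ x, |h x| ≤ M) (hi : Integrable h) :
    ∃ C : ℝ, 0 ≤ C ∧ ∀ y, |reflectedPotential α i h y| ≤ C := by
  obtain ⟨C, hC0, hC⟩ := exists_integral_abs_rieszKernel_mul_le hα0 hαn i hM hi
  refine ⟨C, hC0, fun y => ?_⟩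
  rw [reflectedPotential_eq]
  exact abs_integral_le_integral_abs.trans (hC y)

/-- The Riesz potential commutes with mollification. -/
theorem reflectedPotential_mollify {α : ℝ} (hα0 : 0 < α) (hαn : α < n) (i : Fin n)
    (ρ : Test n) {h : EuclideanSpace ℝ (Fin n) → ℝ} {M : ℝ} (hM : ∀ x, |h x| ≤ M)
    (hm : Measurable h) (hi : Integrable h) (y : EuclideanSpace ℝ (Fin n)) :
    reflectedPotential α i (mollify ρ h) y = mollify ρ (reflectedPotential α i h) y := by
  obtain ⟨C, hC0, hC⟩ := exists_integral_abs_rieszKernel_mul_le hα0 hαn i hM hi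
  have hK := measurable_rieszKernel α i
  have hρ := ρ.continuous.measurable
  have hint : Integrable (Function.uncurry fun z t : EuclideanSpace ℝ (Fin n) =>
      rieszKernel α i z * (ρ t * h (y + z - t))) := by
    have hmeas : AEStronglyMeasurable (Function.uncurry fun z t : EuclideanSpace ℝ (Fin n) =>
        rieszKernel α i z * (ρ t * h (y + z - t))) :=
      Measurable.aestronglyMeasurable (by unfold Function.uncurry; fun_prop)
    have hform : ∀ z t, rieszKernel α i z * (ρ t * h (y + z - t))
        = ρ t * (rieszKernel α i z * h (y - t + z)) := fun z t => by
      rw [show y + z - t = y - t + z by abel]; ring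
    -- With `t` fixed, the integral in `z` is the absolute potential of `h` at `y - t`, which is
    -- bounded uniformly in `t`; `ρ` then gives integrability in `t`.
    rw [Measure.volume_eq_prod, integrable_prod_iff' hmeas]
    simp only [Function.uncurry, hform, norm_mul (ρ _), integral_const_mul]
    refine ⟨ae_of_all _ fun t => (integrable_rieszKernel_mul hα0 hαn i hM hi _).const_mul _, ?_⟩
    refine Integrable.mul_bdd (c := C) ρ.integrable.norm ?_ (ae_of_all _ fun t => ?_)
    · have : StronglyMeasurable fun p : EuclideanSpace ℝ (Fin n) × EuclideanSpace ℝ (Fin n) =>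
          ‖rieszKernel α i p.2 * h (y - p.1 + p.2)‖ := Measurable.stronglyMeasurable (by fun_prop)
      exact this.integral_prod_right.aestronglyMeasurable
    · rw [Real.norm_of_nonneg (integral_nonneg fun _ => norm_nonneg _)]
      exact hC _
  rw [reflectedPotential_eq]
  simp only [mollify, ← integral_const_mul]
  rw [integral_integral_swap hint]
  congr 1; ext t
  rw [reflectedPotential_eq, ← integral_const_mul]
  congr 1; ext z
  rw [show y + z - t = y - t + z by abel]; ring

end mollify

/-! ### The a priori bound for admissible distributions. -/

theorem pairing_eq_smulTest {E : Set (EuclideanSpace ℝ (Fin n))} {T : Dist n}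
    (hT : dsupport T ⊆ E) {χ : Test n} (hχ : χ =ᶠ[𝓝ˢ E] 1) {F : EuclideanSpace ℝ (Fin n) → ℝ}
    (hF : ContDiff ℝ ∞ F) : pairing T F = T (smulTest F hF χ) := by
  refine pairing_eq T F _ ?_
  filter_upwards [hχ.filter_mono (nhdsSet_mono hT)] with x hx
  rw [smulTest_apply, hx, Pi.one_apply, mul_one]

theorem integrable_mul_bounded (ρ : Test n) {h : EuclideanSpace ℝ (Fin n) → ℝ}
    (hm : Measurable h) {M : ℝ} (hM : ∀ x, |h x| ≤ M) (x : EuclideanSpace ℝ (Fin n)) :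
    Integrable fun t => ρ t * h (x - t) :=
  ρ.integrable.mul_bdd (c := M) (hm.comp (by fun_prop)).aestronglyMeasurable
    (ae_of_all _ fun t => hM _)

/-- All derivatives fall on `ρ`, so smallness of `e` itself on a ball controls every derivative of
the mollification on the smaller ball of radius `L`. -/
theorem norm_iteratedFDeriv_mollify_le (ρ : Test n) {e : EuclideanSpace ℝ (Fin n) → ℝ}
    (he : LocallyIntegrable e) {L P τ : ℝ} (hρ : ∀ x ∈ tsupport ρ, ‖x‖ ≤ P)
    (hτ : ∀ y, ‖y‖ ≤ L + P → |e y| ≤ τ) (k : ℕ) {x : EuclideanSpace ℝ (Fin n)} (hx : ‖x‖ ≤ L) :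
    ‖iteratedFDeriv ℝ k (mollify ρ e) x‖ ≤ τ * ∫ t, ‖iteratedFDeriv ℝ k ρ t‖ := by
  have h1 : mollify ρ e = fun x => ∫ t, e t • ρ (x - t) := by
    ext x; rw [mollify_comm]; rfl
  rw [h1, iteratedFDeriv_convolution_right he ρ.contDiff ρ.hasCompactSupport]
  have hi : Integrable fun t => ‖iteratedFDeriv ℝ k ρ t‖ :=
    ((ρ.contDiff.continuous_iteratedFDeriv
      (by exact_mod_cast le_top)).integrable_of_hasCompactSupport
      (ρ.hasCompactSupport.iteratedFDeriv (𝕜 := ℝ) k)).norm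
  have hi' : Integrable fun t => ‖iteratedFDeriv ℝ k ρ (x - t)‖ := hi.comp_sub_left x
  rw [← integral_sub_left_eq_self (fun t => ‖iteratedFDeriv ℝ k ρ t‖) volume x, ← integral_const_mul]
  refine norm_integral_le_of_norm_le (hi'.const_mul τ) (ae_of_all _ fun t => ?_)
  rw [norm_smul]
  by_cases h0 : iteratedFDeriv ℝ k ρ (x - t) = 0
  · simp [h0]
  · have h2 := hρ _ (support_iteratedFDeriv_subset k (Function.mem_support.2 h0))
    refine mul_le_mul_of_nonneg_right (hτ t ?_) (norm_nonneg _)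
    have h3 : t = x - (x - t) := by abel
    rw [h3]
    exact (norm_sub_le _ _).trans (add_le_add hx h2)

theorem abs_reflectedPotential_le_of_support {α : ℝ} (hα0 : 0 < α) (i : Fin n)
    {h : EuclideanSpace ℝ (Fin n) → ℝ} (hi : Integrable h) {y : EuclideanSpace ℝ (Fin n)}
    (hy : ∀ x, h x ≠ 0 → 1 ≤ ‖x - y‖) : |reflectedPotential α i h y| ≤ ∫ x, |h x| := by
  rw [reflectedPotential, ← Real.norm_eq_abs]
  refine norm_integral_le_of_norm_le hi.abs (ae_of_all _ fun x => ?_)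
  rw [norm_mul]
  by_cases h0 : h x = 0
  · simp [h0]
  · exact mul_le_of_le_one_left (norm_nonneg _) (abs_rieszKernel_le_one hα0 i (hy x h0))

/-- The normalisation of the potentials enters the a priori bound here: the pairing is the integral
of `ψ` against a function bounded by `1`. -/
theorem abs_pairing_reflectedPotential_le {α : ℝ} {E : Set (EuclideanSpace ℝ (Fin n))}
    {T : Dist n} (hT : IsAdmissible α E T) (i : Fin n) (ψ : Test n) :
    |pairing T (reflectedPotential α i ψ)| ≤ ∫ x, |ψ x| := by
  obtain ⟨f, hfm, hf1, hf⟩ := hT.2 i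
  rw [hf ψ, ← Real.norm_eq_abs]
  refine norm_integral_le_of_norm_le ψ.integrable.abs ?_
  rw [eLpNorm_exponent_top] at hf1
  filter_upwards [enorm_ae_le_eLpNormEssSup f volume] with x hx
  rw [norm_mul]
  refine mul_le_of_le_one_left (norm_nonneg _) ?_
  have := hx.trans hf1
  rwa [← ofReal_norm, ENNReal.ofReal_le_one] at this

theorem tendsto_integral_indicator_compl_closedBall {g : EuclideanSpace ℝ (Fin n) → ℝ}
    (hg : Integrable g) :
    Tendsto (fun R : ℕ => ∫ x, |(Metric.closedBall 0 (R : ℝ))ᶜ.indicator g x|) atTop (𝓝 0) := by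
  have h0 : (0 : ℝ) = ∫ _ : EuclideanSpace ℝ (Fin n), (0 : ℝ) := by simp
  rw [h0]
  refine tendsto_integral_of_dominated_convergence (fun x => |g x|) (fun R => ?_) hg.abs
    (fun R => ae_of_all _ fun x => ?_) (ae_of_all _ fun x => ?_)
  · exact (hg.indicator Metric.isClosed_closedBall.measurableSet.compl).abs.1
  · rw [Real.norm_eq_abs, abs_abs]
    exact norm_indicator_le_norm_self g x
  · refine tendsto_const_nhds.congr' ?_
    obtain ⟨N, hN⟩ := exists_nat_ge ‖x‖
    filter_upwards [eventually_ge_atTop N] with R hR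
    have : x ∉ (Metric.closedBall (0 : EuclideanSpace ℝ (Fin n)) (R : ℝ))ᶜ := by
      have : (N : ℝ) ≤ R := by exact_mod_cast hR
      simpa using hN.trans this
    rw [indicator_of_notMem this, abs_zero]

/-- The truncated inversion formula. -/
theorem sum_reflectedPotential_mollify_add {α : ℝ} (hα0 : 0 < α) (hαn : α < n) (φ ρ : Test n)
    {s : Set (EuclideanSpace ℝ (Fin n))} (hs : MeasurableSet s) (x : EuclideanSpace ℝ (Fin n)) :
    (∑ i, reflectedPotential α i (mollify ρ (s.indicator (rieszInverse α i φ))) x)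
      + mollify ρ (fun y => ∑ i, reflectedPotential α i (sᶜ.indicator (rieszInverse α i φ)) y) x
      = rieszConst n α * mollify ρ φ x := by
  choose M hM0 hM using exists_abs_rieszInverse_le hα0 hαn (n := n) (φ := φ)
  have hMs : ∀ (s : Set (EuclideanSpace ℝ (Fin n))) i x,
      |s.indicator (rieszInverse α i φ) x| ≤ M i := fun s i x =>
    (norm_indicator_le_norm_self (rieszInverse α i φ) x).trans (hM i x)
  have hms : ∀ (s : Set (EuclideanSpace ℝ (Fin n))) (hs : MeasurableSet s) i,
      Measurable (s.indicator (rieszInverse α i φ)) := fun s hs i =>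
    (measurable_rieszInverse α i φ).indicator hs
  have his : ∀ (s : Set (EuclideanSpace ℝ (Fin n))) (hs : MeasurableSet s) i,
      Integrable (s.indicator (rieszInverse α i φ)) := fun s hs i =>
    (integrable_rieszInverse hα0 hαn i φ).indicator hs
  have hadd : ∀ i y, reflectedPotential α i (s.indicator (rieszInverse α i φ)) y
      + reflectedPotential α i (sᶜ.indicator (rieszInverse α i φ)) y
      = reflectedPotential α i (rieszInverse α i φ) y := by
    intro i y
    simp only [reflectedPotential_eq]
    rw [← integral_add (integrable_rieszKernel_mul hα0 hαn i (hMs s i) (his s hs i) y)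
      (integrable_rieszKernel_mul hα0 hαn i (hMs sᶜ i) (his sᶜ hs.compl i) y)]
    congr 1; ext z
    rw [← mul_add, ← Pi.add_apply (s.indicator _), indicator_self_add_compl]
  have hint : ∀ (s : Set (EuclideanSpace ℝ (Fin n))) (hs : MeasurableSet s) i, Integrable fun t =>
      ρ t * reflectedPotential α i (s.indicator (rieszInverse α i φ)) (x - t) := by
    intro s hs i
    obtain ⟨C, -, hC⟩ := exists_abs_reflectedPotential_le hα0 hαn i (hMs s i) (his s hs i)
    exact integrable_mul_bounded ρ (measurable_reflectedPotential α i (hms s hs i)) hC x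
  simp_rw [reflectedPotential_mollify hα0 hαn _ ρ (hMs s _) (hms s hs _) (his s hs _)]
  simp only [mollify, Finset.mul_sum]
  rw [integral_finsetSum _ fun i _ => hint sᶜ hs.compl i, ← Finset.sum_add_distrib]
  simp_rw [← integral_add (hint s hs _) (hint sᶜ hs.compl _), ← mul_add, hadd]
  rw [← integral_const_mul, ← integral_finsetSum]
  · congr 1; ext t
    rw [← Finset.mul_sum, sum_reflectedPotential_rieszInverse hα0 hαn]; ring
  · intro i _
    simp_rw [← hadd, mul_add]
    exact (hint s hs i).add (hint sᶜ hs.compl i)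

/-- `IsRieszPotential` may only be used on test functions, so `rieszInverse` is cut to a ball of
radius `R` and mollified, which does not increase its `L¹` norm. The potential of the discarded tail
tends to `0` with all derivatives near the support of `χ`, where alone it matters, and `T` has
finite order. -/
theorem abs_apply_mollify_le {α : ℝ} (hα0 : 0 < α) (hαn : α < n)
    {E : Set (EuclideanSpace ℝ (Fin n))} {T : Dist n} (hT : IsAdmissible α E T) {χ : Test n}
    (hχ : χ =ᶠ[𝓝ˢ E] 1) (φ ρ : Test n) (hρ0 : ∀ x, 0 ≤ ρ x) (hρ1 : ∫ x, ρ x = 1) :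
    |rieszConst n α| * |T (smulTest (mollify ρ φ)
        (contDiff_mollify ρ φ.integrable.locallyIntegrable) χ)|
      ≤ ∑ i, ∫ x, |rieszInverse α i φ x| := by
  obtain ⟨N, C, hC0, hC⟩ := exists_bound_smulTest T χ
  obtain ⟨L, hL⟩ := χ.hasCompactSupport.isCompact.isBounded.exists_norm_le
  obtain ⟨P, hP⟩ := ρ.hasCompactSupport.isCompact.isBounded.exists_norm_le
  choose M hM0 hM using exists_abs_rieszInverse_le hα0 hαn (n := n) (φ := φ)
  set B : ℕ → Set (EuclideanSpace ℝ (Fin n)) := fun R => Metric.closedBall 0 (R : ℝ) with hB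
  have hBm : ∀ R, MeasurableSet (B R) := fun R => Metric.isClosed_closedBall.measurableSet
  set g : Fin n → EuclideanSpace ℝ (Fin n) → ℝ := fun i => rieszInverse α i φ with hg
  have hgi : ∀ i, Integrable (g i) := fun i => integrable_rieszInverse hα0 hαn i φ
  have hMs : ∀ (s : Set (EuclideanSpace ℝ (Fin n))) i x, |s.indicator (g i) x| ≤ M i :=
    fun s i x => (norm_indicator_le_norm_self (g i) x).trans (hM i x)
  set e : ℕ → EuclideanSpace ℝ (Fin n) → ℝ := fun R y =>
    ∑ i, reflectedPotential α i ((B R)ᶜ.indicator (g i)) y with he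
  have hel : ∀ R, LocallyIntegrable (e R) := by
    intro R
    refine locallyIntegrable_finsetSum _ fun i _ => ?_
    obtain ⟨D, -, hD⟩ := exists_abs_reflectedPotential_le hα0 hαn i (hMs (B R)ᶜ i)
      ((hgi i).indicator (hBm R).compl)
    exact locallyIntegrable_of_bounded (measurable_reflectedPotential α i
      ((measurable_rieszInverse α i φ).indicator (hBm R).compl)) hD
  set τ : ℕ → ℝ := fun R => ∑ i, ∫ x, |(B R)ᶜ.indicator (g i) x| with hτ
  have hτ0 : ∀ R, 0 ≤ τ R := fun R => Finset.sum_nonneg fun i _ =>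
    integral_nonneg fun x => abs_nonneg _
  have hτlim : Tendsto τ atTop (𝓝 0) := by
    have : (0 : ℝ) = ∑ i : Fin n, 0 := by simp
    rw [this]
    exact tendsto_finsetSum _ fun i _ => tendsto_integral_indicator_compl_closedBall (hgi i)
  -- `L` bounds the support of `χ` and `P` that of `ρ`; the extra `1` keeps the tail at distance at
  -- least `1`, where the kernel is at most `1`.
  have heτ : ∀ R : ℕ, L + P + 1 ≤ R → ∀ y, ‖y‖ ≤ L + P → |e R y| ≤ τ R := by
    intro R hR y hy
    refine (Finset.abs_sum_le_sum_abs _ _).trans (Finset.sum_le_sum fun i _ => ?_)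
    refine abs_reflectedPotential_le_of_support hα0 i ((hgi i).indicator (hBm R).compl)
      fun x hx => ?_
    have hxR : (R : ℝ) < ‖x‖ := by
      have := mem_of_indicator_ne_zero hx
      simpa [hB] using this
    have := norm_sub_norm_le x y
    linarith
  set I : ℝ := ∑ k ∈ Finset.range (N + 1), ∫ t, ‖iteratedFDeriv ℝ k ρ t‖ with hI
  have hI0 : ∀ k, 0 ≤ ∫ t, ‖iteratedFDeriv ℝ k ρ t‖ := fun k =>
    integral_nonneg fun t => norm_nonneg _
  have herr : ∀ R : ℕ, L + P + 1 ≤ R →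
      |T (smulTest (mollify ρ (e R)) (contDiff_mollify ρ (hel R)) χ)| ≤ C * (τ R * I) := by
    intro R hR
    refine hC _ _ _ (mul_nonneg (hτ0 R) (Finset.sum_nonneg fun k _ => hI0 k)) fun k hk x hx => ?_
    refine (norm_iteratedFDeriv_mollify_le ρ (hel R) hP (heτ R hR) k (hL x hx)).trans ?_
    exact mul_le_mul_of_nonneg_left (Finset.single_le_sum (f := fun k =>
      ∫ t, ‖iteratedFDeriv ℝ k ρ t‖) (fun k _ => hI0 k) (Finset.mem_range.2 (by omega))) (hτ0 R)
  have hmain : ∀ R : ℕ, L + P + 1 ≤ R → |rieszConst n α| * |T (smulTest (mollify ρ φ)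
        (contDiff_mollify ρ φ.integrable.locallyIntegrable) χ)|
      ≤ (∑ i, ∫ x, |g i x|) + C * (τ R * I) := by
    intro R hR
    have hli : ∀ i, LocallyIntegrable ((B R).indicator (g i)) := fun i =>
      ((hgi i).indicator (hBm R)).locallyIntegrable
    have hcs : ∀ i, HasCompactSupport ((B R).indicator (g i)) := fun i =>
      HasCompactSupport.intro (isCompact_closedBall 0 (R : ℝ)) fun x hx =>
        indicator_of_notMem hx _
    set ψ : Fin n → Test n := fun i => mollifyTest ρ ((B R).indicator (g i)) (hli i) (hcs i)
    have hψ : ∀ i, (ψ i : EuclideanSpace ℝ (Fin n) → ℝ) = mollify ρ ((B R).indicator (g i)) :=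
      fun i => rfl
    have hid : rieszConst n α • smulTest (mollify ρ φ)
        (contDiff_mollify ρ φ.integrable.locallyIntegrable) χ
        = (∑ i, smulTest (reflectedPotential α i (ψ i))
          (contDiff_reflectedPotential hα0 hαn i (ψ i)) χ)
          + smulTest (mollify ρ (e R)) (contDiff_mollify ρ (hel R)) χ := by
      ext x
      have h1 := sum_reflectedPotential_mollify_add hα0 hαn φ ρ (hBm R) x
      rw [FunLike.coe_add, Pi.add_apply, FunLike.coe_sum, Finset.sum_apply, FunLike.coe_smul,
        Pi.smul_apply]
      simp only [smulTest_apply, smul_eq_mul, hψ]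
      rw [← Finset.sum_mul, ← add_mul, h1]; ring
    have h2 := congrArg T hid
    rw [map_smul, map_add, map_sum, smul_eq_mul] at h2
    rw [← abs_mul, h2]
    refine (abs_add_le _ _).trans (add_le_add ?_ (herr R hR))
    refine (Finset.abs_sum_le_sum_abs _ _).trans (Finset.sum_le_sum fun i _ => ?_)
    rw [← pairing_eq_smulTest hT.1 hχ]
    refine (abs_pairing_reflectedPotential_le hT i (ψ i)).trans ?_
    rw [hψ]
    refine (integral_abs_mollify_le ρ.continuous.measurable hρ0 ρ.integrable hρ1
      ((measurable_rieszInverse α i φ).indicator (hBm R)) ((hgi i).indicator (hBm R))).trans ?_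
    exact integral_mono ((hgi i).indicator (hBm R)).abs (hgi i).abs fun x =>
      norm_indicator_le_norm_self (g i) x
  have hlim : Tendsto (fun R => (∑ i, ∫ x, |g i x|) + C * (τ R * I)) atTop
      (𝓝 ((∑ i, ∫ x, |g i x|) + C * (0 * I))) :=
    ((hτlim.mul_const I).const_mul C).const_add _
  rw [zero_mul, mul_zero, add_zero] at hlim
  obtain ⟨R₀, hR₀⟩ := exists_nat_ge (L + P + 1)
  refine ge_of_tendsto hlim ?_
  filter_upwards [eventually_ge_atTop R₀] with R hR
  exact hmain R (hR₀.trans (by exact_mod_cast hR))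

/-- The normalized bump function as a test function. -/
def bumpTest (b : ContDiffBump (0 : EuclideanSpace ℝ (Fin n))) : Test n where
  toFun := b.normed volume
  contDiff' := b.contDiff_normed
  hasCompactSupport' := b.hasCompactSupport_normed
  tsupport_subset' := by simp

/-- Each derivative of `φ` is uniformly continuous; the outer radius of the bump is the least
modulus among the orders up to `N`. -/
theorem exists_norm_iteratedFDeriv_mollify_sub_le (φ : Test n) (N : ℕ) {ε : ℝ} (hε : 0 < ε) :
    ∃ b : ContDiffBump (0 : EuclideanSpace ℝ (Fin n)), ∀ k ≤ N, ∀ x,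
      ‖iteratedFDeriv ℝ k (fun x => mollify (bumpTest b) φ x - φ x) x‖ ≤ ε := by
  have hcont : ∀ k, Continuous (iteratedFDeriv ℝ k φ) := fun k =>
    φ.contDiff.continuous_iteratedFDeriv (by exact_mod_cast le_top)
  have huc : ∀ k, ∃ δ > 0, ∀ x y, dist x y < δ →
      dist (iteratedFDeriv ℝ k φ x) (iteratedFDeriv ℝ k φ y) < ε := fun k => by
    obtain ⟨δ, hδ, h⟩ := Metric.uniformContinuous_iff.1
      ((φ.hasCompactSupport.iteratedFDeriv (𝕜 := ℝ) k).uniformContinuous_of_continuous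
        (hcont k)) ε hε
    exact ⟨δ, hδ, fun x y hxy => h hxy⟩
  choose δ hδ0 hδ using huc
  have hδN : ∃ δ' > 0, ∀ k ≤ N, δ' ≤ δ k := by
    have hne : (Finset.range (N + 1)).Nonempty := ⟨0, by simp⟩
    refine ⟨(Finset.range (N + 1)).inf' hne δ, ?_, fun k hk => ?_⟩
    · exact (Finset.lt_inf'_iff hne).2 fun k _ => hδ0 k
    · exact Finset.inf'_le δ (Finset.mem_range.2 (by omega))
  obtain ⟨δ', hδ'0, hδ'⟩ := hδN
  refine ⟨⟨δ' / 2, δ', by positivity, by linarith⟩, fun k hk x => ?_⟩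
  set b : ContDiffBump (0 : EuclideanSpace ℝ (Fin n)) := ⟨δ' / 2, δ', by positivity, by linarith⟩
  have h1 : ContDiff ℝ ∞ (mollify (bumpTest b) φ) :=
    contDiff_mollify _ φ.integrable.locallyIntegrable
  have h2 : iteratedFDeriv ℝ k (fun x => mollify (bumpTest b) φ x - φ x) x
      = iteratedFDeriv ℝ k (mollify (bumpTest b) φ) x - iteratedFDeriv ℝ k φ x :=
    fun_iteratedFDeriv_sub_apply (h1.contDiffAt.of_le (by exact_mod_cast le_top))
      (φ.contDiff.contDiffAt.of_le (by exact_mod_cast le_top))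
  have h3 : iteratedFDeriv ℝ k (mollify (bumpTest b) φ) x
      = ∫ t, b.normed volume t • iteratedFDeriv ℝ k φ (x - t) :=
    iteratedFDeriv_convolution_right (bumpTest b).integrable.locallyIntegrable φ.contDiff
      φ.hasCompactSupport k x
  rw [h2, h3, ← dist_eq_norm]
  refine b.dist_normed_convolution_le (μ := volume) (hcont k).aestronglyMeasurable fun y hy => ?_
  exact (hδ k y x (lt_of_lt_of_le hy (hδ' k hk))).le

/-- The reproduction formula controls an admissible distribution. -/
theorem abs_apply_le {α : ℝ} (hα0 : 0 < α) (hαn : α < n)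
    {E : Set (EuclideanSpace ℝ (Fin n))} (hE : IsCompact E) {T : Dist n}
    (hT : IsAdmissible α E T) (φ : Test n) :
    |rieszConst n α| * |T φ| ≤ ∑ i, ∫ x, |rieszInverse α i φ x| := by
  obtain ⟨χ, hχ⟩ := exists_test_eventuallyEq hE (g := 1) contDiff_const
  obtain ⟨N, C, hC0, hC⟩ := exists_bound_smulTest T χ
  have hTφ : T φ = T (smulTest φ φ.contDiff χ) := by
    refine apply_eq_of_eventuallyEq T _ _ ?_
    filter_upwards [hχ.filter_mono (nhdsSet_mono hT.1)] with x hx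
    rw [smulTest_apply, hx, Pi.one_apply, mul_one]
  refine le_of_forall_pos_le_add fun ε hε => ?_
  -- The `+ 1` keeps the denominator positive even when `C = 0`.
  set ε' : ℝ := ε / (|rieszConst n α| * C + 1) with hε'
  have hden : 0 < |rieszConst n α| * C + 1 := by positivity
  have hε'0 : 0 < ε' := by positivity
  obtain ⟨b, hb⟩ := exists_norm_iteratedFDeriv_mollify_sub_le φ N hε'0
  have hsm := contDiff_mollify (bumpTest b) φ.integrable.locallyIntegrable
  have h1 := abs_apply_mollify_le hα0 hαn hT hχ φ (bumpTest b) (fun x => b.nonneg_normed x)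
    b.integral_normed
  have h2 := hC (fun x => mollify (bumpTest b) φ x - φ x) (hsm.sub φ.contDiff) ε' hε'0.le
    fun k hk x _ => hb k hk x
  have h3 : smulTest (fun x => mollify (bumpTest b) φ x - φ x) (hsm.sub φ.contDiff) χ
      = smulTest (mollify (bumpTest b) φ) hsm χ - smulTest φ φ.contDiff χ := by
    ext x
    rw [FunLike.coe_sub, Pi.sub_apply]
    simp only [smulTest_apply, sub_mul]
  rw [h3, map_sub, ← hTφ] at h2
  have h4 : |T φ| ≤ |T (smulTest (mollify (bumpTest b) φ) hsm χ)| + C * ε' := by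
    have := abs_sub_abs_le_abs_sub (T φ) (T (smulTest (mollify (bumpTest b) φ) hsm χ))
    rw [abs_sub_comm] at this
    linarith
  have h5 : |rieszConst n α| * (C * ε') ≤ ε := by
    rw [hε', ← mul_assoc, mul_div_assoc', div_le_iff₀ hden]
    nlinarith
  calc _ ≤ |rieszConst n α| * (|T (smulTest (mollify (bumpTest b) φ) hsm χ)| + C * ε') :=
        mul_le_mul_of_nonneg_left h4 (abs_nonneg _)
    _ ≤ _ := by rw [mul_add]; exact add_le_add h1 h5

/-! ### Weak compactness of admissible distributions and of the unit ball of `L^∞`. -/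

theorem integral_abs_ofSupportedIn_le {K : TopologicalSpace.Compacts (EuclideanSpace ℝ (Fin n))}
    (f : ContDiffMapSupportedIn (EuclideanSpace ℝ (Fin n)) ℝ ⊤ K) :
    ∫ x, |f x| ≤ volume.real (K : Set (EuclideanSpace ℝ (Fin n)))
      * ContDiffMapSupportedIn.seminorm ℝ (EuclideanSpace ℝ (Fin n)) ℝ ⊤ K 0 f := by
  have h1 : ∫ x, |f x| = ∫ x in (K : Set (EuclideanSpace ℝ (Fin n))), |f x| := by
    refine (setIntegral_eq_integral_of_forall_compl_eq_zero fun x hx => ?_).symm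
    rw [f.zero_on_compl hx, Pi.zero_apply, abs_zero]
  rw [h1, mul_comm]
  refine (le_abs_self _).trans (norm_setIntegral_le_of_norm_le_const (f := fun x => |f x|)
    K.isCompact.measure_lt_top fun x _ => ?_)
  rw [Real.norm_eq_abs, abs_abs]
  exact ContDiffMapSupportedIn.norm_apply_le_seminorm ℝ (f := f)

/-- The inclusion of test functions in `L¹`. -/
def toL1 : Test n →L[ℝ] Lp ℝ 1 (volume : Measure (EuclideanSpace ℝ (Fin n))) :=
  TestFunction.mkCLM ℝ (fun f => (Test.integrable f).toL1 f)
    (fun f g => Integrable.toL1_add f g (Test.integrable f) (Test.integrable g))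
    (fun c f => Integrable.toL1_smul f (Test.integrable f) c)
    (fun K hK => (ContDiffMapSupportedIn.mkCLMtoNormedSpace ℝ
      (fun f => (Test.integrable (TestFunction.ofSupportedIn hK f)).toL1 _)
      (fun f g => Integrable.toL1_add (TestFunction.ofSupportedIn hK f)
        (TestFunction.ofSupportedIn hK g) (Test.integrable _) (Test.integrable _))
      (fun c f => Integrable.toL1_smul (TestFunction.ofSupportedIn hK f) (Test.integrable _) c)
      ⟨{0}, volume.real (K : Set (EuclideanSpace ℝ (Fin n))), measureReal_nonneg, fun f => by
        rw [L1.norm_of_fun_eq_integral_norm, Finset.sup_singleton]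
        exact integral_abs_ofSupportedIn_le f⟩).continuous)

theorem continuous_integral_abs : Continuous fun φ : Test n => ∫ x, |φ x| :=
  (toL1 (n := n)).continuous.norm.congr fun φ => L1.norm_of_fun_eq_integral_norm φ.integrable

/-- Continuity of `q` and `q 0 = 0` are all that is needed to make a pointwise limit of admissible
distributions continuous at `0`. -/
theorem exists_continuous_sum_integral_abs_rieszInverse_le {α : ℝ} (hα0 : 0 < α) (hαn : α < n) :
    ∃ q : Test n → ℝ, Continuous q ∧ q 0 = 0 ∧
      ∀ φ, ∑ i, ∫ x, |rieszInverse α i φ x| ≤ q φ := by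
  set A := ∫ r in Ioi (0 : ℝ), r ^ (-heatExp n α) * heatWeight n r
  have hA : 0 ≤ A := setIntegral_nonneg measurableSet_Ioi fun r hr =>
    mul_nonneg (Real.rpow_nonneg (le_of_lt hr) _) (heatWeight_nonneg hr)
  refine ⟨fun φ => ∑ i, A * ((∫ x, |(laplace^[n]) (partialDeriv i φ) x|)
    + heatConst n * ∫ x, |φ x|), ?_, ?_, fun φ => Finset.sum_le_sum fun i _ => ?_⟩
  · refine continuous_finsetSum _ fun i _ => continuous_const.mul (Continuous.add ?_
      (continuous_const.mul continuous_integral_abs))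
    exact continuous_integral_abs.comp
      ((laplace.continuous.iterate n).comp (partialDeriv i).continuous)
  · simp [iterate_map_zero]
  · have h := lintegral_enorm_rieszInverse_le hα0 hαn i φ
    have e : ∀ ψ : Test n, ∫⁻ x, ‖ψ x‖ₑ = ENNReal.ofReal (∫ x, |ψ x|) := fun ψ =>
      (ofReal_integral_norm_eq_lintegral_enorm ψ.integrable).symm
    have e0 : ∀ ψ : Test n, 0 ≤ ∫ x, |ψ x| := fun ψ => integral_nonneg fun x => abs_nonneg _
    rw [← ofReal_integral_norm_eq_lintegral_enorm (integrable_rieszInverse hα0 hαn i φ), e, e,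
      ← ENNReal.ofReal_mul heatConst_nonneg, ← ENNReal.ofReal_add (e0 _)
        (mul_nonneg heatConst_nonneg (e0 _)), ← ENNReal.ofReal_mul hA] at h
    exact (ENNReal.ofReal_le_ofReal_iff (mul_nonneg hA (add_nonneg (e0 _)
      (mul_nonneg heatConst_nonneg (e0 _))))).1 h

theorem exists_tendsto_of_abs_le (U : Ultrafilter ℕ) {u : ℕ → ℝ} {C : ℝ} (h : ∀ j, |u j| ≤ C) :
    ∃ l, Tendsto u U (𝓝 l) := by
  obtain ⟨l, -, hl⟩ := (isCompact_Icc (a := -C) (b := C)).ultrafilter_le_nhds (U.map u)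
    (le_principal_iff.2 (Filter.mem_map.2 (univ_mem' fun j => abs_le.1 (h j))))
  exact ⟨l, hl⟩

/-- Distributions admissible for a fixed compact set are weakly relatively compact. -/
theorem exists_tendsto_apply {α : ℝ} (hα0 : 0 < α) (hαn : α < n)
    {E : Set (EuclideanSpace ℝ (Fin n))} (hE : IsCompact E) {T : ℕ → Dist n}
    (hT : ∀ j, IsAdmissible α E (T j)) (U : Ultrafilter ℕ) :
    ∃ S : Dist n, ∀ φ, Tendsto (fun j => T j φ) U (𝓝 (S φ)) := by
  obtain ⟨q, hqc, hq0, hq⟩ := exists_continuous_sum_integral_abs_rieszInverse_le hα0 hαn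
  have hc : 0 < |rieszConst n α| := abs_pos.2 (rieszConst_ne_zero hα0 hαn)
  have hb : ∀ j φ, |T j φ| ≤ |rieszConst n α|⁻¹ * q φ := fun j φ => by
    rw [← div_eq_inv_mul, le_div_iff₀' hc]
    exact (abs_apply_le hα0 hαn hE (hT j) φ).trans (hq φ)
  -- Along an ultrafilter every bounded sequence converges, so the limits exist for all `φ` at once,
  -- without extracting subsequences.
  choose S hS using fun φ => exists_tendsto_of_abs_le U fun j => hb j φ
  let S' : Test n →ₗ[ℝ] ℝ :=
    { toFun := S
      map_add' := fun φ ψ => tendsto_nhds_unique (hS (φ + ψ)) <| by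
        simpa only [map_add] using (hS φ).add (hS ψ)
      map_smul' := fun c φ => tendsto_nhds_unique (hS (c • φ)) <| by
        simpa only [map_smul, smul_eq_mul, RingHom.id_apply] using (hS φ).const_mul c }
  have hSb : ∀ φ, ‖S' φ‖ ≤ |rieszConst n α|⁻¹ * q φ := fun φ =>
    le_of_tendsto (hS φ).abs (univ_mem' fun j => hb j φ)
  have hcont : Continuous S' := by
    refine continuous_of_continuousAt_zero S' ?_
    rw [ContinuousAt, map_zero]
    refine squeeze_zero_norm hSb ?_
    simpa [hq0] using (hqc.tendsto 0).const_mul |rieszConst n α|⁻¹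
  exact ⟨{ toFun := S, map_add' := S'.map_add', map_smul' := S'.map_smul', cont := hcont }, hS⟩

/-- Weak compactness of the unit ball of `L^∞`, tested against `L²`, for a finite measure. -/
theorem exists_tendsto_integral_mul {X : Type*} [MeasurableSpace X] (μ : Measure X)
    [IsFiniteMeasure μ] {f : ℕ → X → ℝ} (hfm : ∀ j, AEStronglyMeasurable (f j) μ)
    (hf : ∀ j, ∀ᵐ x ∂μ, |f j x| ≤ 1) (U : Ultrafilter ℕ) :
    ∃ g : X → ℝ, Measurable g ∧ (∀ᵐ x ∂μ, |g x| ≤ 1) ∧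
      ∀ u : X → ℝ, MemLp u 2 μ →
        Tendsto (fun j => ∫ x, f j x * u x ∂μ) U (𝓝 (∫ x, g x * u x ∂μ)) := by
  have hL : ∀ j, MemLp (f j) 2 μ := fun j => MemLp.of_bound (hfm j) 1 (hf j)
  obtain ⟨C, hC⟩ : ∃ C, ∀ j, ‖(hL j).toLp‖ ≤ C := by
    refine ⟨_, fun j => Lp.norm_le_of_ae_bound (p := 2) (C := 1) zero_le_one ?_⟩
    filter_upwards [(hL j).coeFn_toLp, hf j] with x hx hx'
    rwa [hx]
  let D : ℕ → WeakDual ℝ (Lp ℝ 2 μ) := fun j =>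
    StrongDual.toWeakDual (InnerProductSpace.toDual ℝ (Lp ℝ 2 μ) (hL j).toLp)
  -- On a finite measure space the `f j` are bounded in `L²`; Banach–Alaoglu and Riesz
  -- representation give a weak limit `G` in `L²`.
  obtain ⟨ℓ, -, hℓ⟩ := (WeakDual.isCompact_closedBall (0 : StrongDual ℝ (Lp ℝ 2 μ)) C
    ).ultrafilter_le_nhds (U.map D) (le_principal_iff.2 (Filter.mem_map.2 (univ_mem' fun j => by
      change InnerProductSpace.toDual ℝ (Lp ℝ 2 μ) (hL j).toLp ∈ Metric.closedBall 0 C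
      rw [mem_closedBall_zero_iff, LinearIsometryEquiv.norm_map]
      exact hC j)))
  set G : Lp ℝ 2 μ := (InnerProductSpace.toDual ℝ (Lp ℝ 2 μ)).symm (WeakDual.toStrongDual ℓ)
  have hGm := (Lp.aestronglyMeasurable G).aemeasurable
  have hlim : ∀ u : X → ℝ, MemLp u 2 μ →
      Tendsto (fun j => ∫ x, f j x * u x ∂μ) U (𝓝 (∫ x, hGm.mk G x * u x ∂μ)) := by
    intro u hu
    have h1 : Tendsto (fun j => D j hu.toLp) U (𝓝 (ℓ hu.toLp)) :=
      ((WeakDual.eval_continuous hu.toLp).tendsto ℓ).comp hℓ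
    have h2 : ∀ j, D j hu.toLp = ∫ x, f j x * u x ∂μ := by
      intro j
      change InnerProductSpace.toDual ℝ (Lp ℝ 2 μ) (hL j).toLp hu.toLp = _
      rw [InnerProductSpace.toDual_apply_apply, L2.inner_def]
      refine integral_congr_ae ?_
      filter_upwards [(hL j).coeFn_toLp, hu.coeFn_toLp] with x hx hx'
      rw [hx, hx', real_inner_eq_re_inner]
      simp [mul_comm]
    have h3 : ℓ hu.toLp = ∫ x, hGm.mk G x * u x ∂μ := by
      have : ℓ hu.toLp = InnerProductSpace.toDual ℝ (Lp ℝ 2 μ) G hu.toLp := by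
        rw [LinearIsometryEquiv.apply_symm_apply]; rfl
      rw [this, InnerProductSpace.toDual_apply_apply, L2.inner_def]
      refine integral_congr_ae ?_
      filter_upwards [hGm.ae_eq_mk, hu.coeFn_toLp] with x hx hx'
      rw [hx, hx', real_inner_eq_re_inner]
      simp [mul_comm]
    simpa only [h2, h3] using h1
  have hGi : Integrable (hGm.mk G) μ :=
    ((Lp.memLp G).integrable (by norm_num)).congr hGm.ae_eq_mk
  -- Testing against indicators recovers the bound `1` almost everywhere, which convergence in `L²`
  -- alone does not show.
  have hset : ∀ s, MeasurableSet s → |∫ x in s, hGm.mk G x ∂μ| ≤ μ.real s := by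
    intro s hs
    have h1 := hlim (s.indicator 1) ((memLp_const (1 : ℝ)).indicator hs)
    have h2 : ∀ v : X → ℝ, ∫ x, v x * s.indicator 1 x ∂μ = ∫ x in s, v x ∂μ := by
      intro v
      rw [← integral_indicator hs]
      congr 1; ext x
      by_cases hx : x ∈ s <;> simp [hx]
    simp only [h2] at h1
    refine le_of_tendsto h1.abs (univ_mem' fun j => ?_)
    have := norm_setIntegral_le_of_norm_le_const_ae' (μ := μ) (s := s) (f := f j) (C := 1)
      (measure_lt_top μ s) ((hf j).mono fun x hx _ => hx)
    simpa using this
  refine ⟨hGm.mk G, hGm.measurable_mk, ?_, hlim⟩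
  have hle : hGm.mk G ≤ᵐ[μ] fun _ => 1 :=
    ae_le_of_forall_setIntegral_le hGi (integrable_const _) fun s hs _ => by
      simpa using (le_abs_self _).trans (hset s hs)
  have hge : (fun _ => -1) ≤ᵐ[μ] hGm.mk G :=
    ae_le_of_forall_setIntegral_le (integrable_const _) hGi fun s hs _ => by
      simpa using (abs_le.1 (hset s hs)).1
  filter_upwards [hle, hge] with x h1 h2
  exact abs_le.2 ⟨h2, h1⟩

theorem heatKernel_pos {s : ℝ} (hs : 0 < s) (z : EuclideanSpace ℝ (Fin n)) :
    0 < heatKernel s z := by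
  unfold heatKernel; positivity

/-- Weak compactness of the unit ball of `L^∞(ℝⁿ)`, tested against test functions. -/
theorem exists_tendsto_integral_mul_test {f : ℕ → EuclideanSpace ℝ (Fin n) → ℝ}
    (hfm : ∀ j, AEStronglyMeasurable (f j) volume) (hf : ∀ j, eLpNorm (f j) ⊤ volume ≤ 1)
    (U : Ultrafilter ℕ) :
    ∃ g : EuclideanSpace ℝ (Fin n) → ℝ, AEStronglyMeasurable g volume ∧
      eLpNorm g ⊤ volume ≤ 1 ∧
      ∀ φ : Test n, Tendsto (fun j => ∫ x, f j x * φ x) U (𝓝 (∫ x, g x * φ x)) := by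
  -- A positive continuous integrable weight makes Lebesgue measure finite without changing its null
  -- sets; test functions are divided by `w` to compensate.
  set w : EuclideanSpace ℝ (Fin n) → ℝ := heatKernel 1
  have hw0 : ∀ x, 0 < w x := heatKernel_pos one_pos
  have hwc : Continuous w := continuous_heatKernel 1
  have hwm : Measurable fun x => ENNReal.ofReal (w x) := hwc.measurable.ennreal_ofReal
  set μ : Measure (EuclideanSpace ℝ (Fin n)) := volume.withDensity fun x => ENNReal.ofReal (w x)
  have : IsFiniteMeasure μ :=
    isFiniteMeasure_withDensity_ofReal (integrable_heatKernel one_pos).2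
  have hμ : μ ≪ volume := withDensity_absolutelyContinuous _ _
  have hμ' : volume ≪ μ := withDensity_absolutelyContinuous' hwm.aemeasurable
    (ae_of_all _ fun x => by simpa using hw0 x)
  have hf1 : ∀ j, ∀ᵐ x, |f j x| ≤ 1 := by
    intro j
    have h := hf j
    rw [eLpNorm_exponent_top] at h
    filter_upwards [enorm_ae_le_eLpNormEssSup (f j) volume] with x hx
    have := hx.trans h
    rwa [← ofReal_norm, ENNReal.ofReal_le_one] at this
  obtain ⟨g, hgm, hg1, hg⟩ := exists_tendsto_integral_mul μ (fun j => (hfm j).mono_ac hμ)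
    (fun j => hμ.ae_le (hf1 j)) U
  refine ⟨g, hgm.aestronglyMeasurable, ?_, fun φ => ?_⟩
  · rw [eLpNorm_exponent_top]
    refine essSup_le_of_ae_le _ ?_
    filter_upwards [hμ'.ae_le hg1] with x hx
    rwa [← ofReal_norm, ENNReal.ofReal_le_one]
  · have hu : MemLp (fun x => φ x / w x) 2 μ := by
      have hc : Continuous fun x => φ x / w x := φ.continuous.div hwc fun x => (hw0 x).ne'
      have hs : HasCompactSupport fun x => φ x / w x :=
        φ.hasCompactSupport.mono fun x hx h => hx (by simp [h])
      obtain ⟨C, hC⟩ := hs.exists_bound_of_continuous hc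
      exact MemLp.of_bound hc.aestronglyMeasurable C (ae_of_all _ hC)
    have he : ∀ v : EuclideanSpace ℝ (Fin n) → ℝ,
        ∫ x, v x * (φ x / w x) ∂μ = ∫ x, v x * φ x := by
      intro v
      rw [integral_withDensity_eq_integral_toReal_smul hwm (by simp)]
      congr 1; ext x
      rw [ENNReal.toReal_ofReal (hw0 x).le, smul_eq_mul]
      field_simp [(hw0 x).ne']
    simpa only [he] using hg _ hu

/-! ### Monotonicity, finiteness and continuity from above of the capacity. -/

theorem IsAdmissible.mono {α : ℝ} {E F : Set (EuclideanSpace ℝ (Fin n))} {T : Dist n}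
    (hT : IsAdmissible α E T) (h : E ⊆ F) : IsAdmissible α F T :=
  ⟨hT.1.trans h, hT.2⟩

theorem capacity_mono {α : ℝ} {E F : Set (EuclideanSpace ℝ (Fin n))} (h : E ⊆ F) :
    capacity α E ≤ capacity α F :=
  iSup₂_le fun T hT => le_iSup₂_of_le T (hT.mono h) le_rfl

theorem pairing_eq_apply {E : Set (EuclideanSpace ℝ (Fin n))} {T : Dist n}
    (hT : dsupport T ⊆ E) {g : EuclideanSpace ℝ (Fin n) → ℝ} {ψ : Test n} (h : ψ =ᶠ[𝓝ˢ E] g) :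
    pairing T g = T ψ :=
  pairing_eq T g ψ (h.filter_mono (nhdsSet_mono hT))

theorem capacity_lt_top {α : ℝ} (hα0 : 0 < α) (hαn : α < n)
    {E : Set (EuclideanSpace ℝ (Fin n))} (hE : IsCompact E) : capacity α E < ⊤ := by
  obtain ⟨χ, hχ⟩ := exists_test_eventuallyEq hE (g := 1) contDiff_const
  have hc : 0 < |rieszConst n α| := abs_pos.2 (rieszConst_ne_zero hα0 hαn)
  refine lt_of_le_of_lt (iSup₂_le fun T hT => ENNReal.ofReal_le_ofReal ?_)
    (ENNReal.ofReal_lt_top (r := (∑ i, ∫ x, |rieszInverse α i χ x|) / |rieszConst n α|))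
  rw [pairing_eq_apply hT.1 hχ, le_div_iff₀' hc]
  exact abs_apply_le hα0 hαn hE hT χ

/-- The support of a weak limit is contained in the limit of the supports. -/
theorem dsupport_subset_iInter {E : ℕ → Set (EuclideanSpace ℝ (Fin n))}
    (hE : ∀ j, IsCompact (E j)) (hmono : Antitone E) {T : ℕ → Dist n}
    (hT : ∀ j, dsupport (T j) ⊆ E j) {U : Filter ℕ} [U.NeBot] (hU : U ≤ atTop) {S : Dist n}
    (hS : ∀ φ, Tendsto (fun j => T j φ) U (𝓝 (S φ))) : dsupport S ⊆ ⋂ j, E j := by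
  refine sInter_subset_of_mem ⟨fun u hu => ?_, isClosed_iInter fun j => (hE j).isClosed⟩
  -- By compactness, if the support of `u` misses the intersection it already misses some `E N`, so
  -- `T j u = 0` from then on.
  obtain ⟨N, hN⟩ : ∃ N, E N ∩ tsupport u = ∅ := by
    by_contra! h
    obtain ⟨x, hx⟩ := IsCompact.nonempty_iInter_of_sequence_nonempty_isCompact_isClosed
      (fun j => E j ∩ tsupport u)
      (fun j => inter_subset_inter_left _ (hmono (Nat.le_succ j))) h
      ((hE 0).inter_right (isClosed_tsupport u))
      (fun j => (hE j).isClosed.inter (isClosed_tsupport u))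
    rw [mem_iInter] at hx
    exact hu (hx 0).2 (mem_iInter.2 fun j => (hx j).1)
  refine tendsto_nhds_unique (hS u) (tendsto_const_nhds.congr' ?_)
  filter_upwards [hU (eventually_ge_atTop N)] with j hj
  refine (isVanishingOn_compl_dsupport (T j) u fun x hx hxT => ?_).symm
  exact eq_empty_iff_forall_notMem.1 hN x ⟨hmono hj (hT j hxT), hx⟩

/-- A subsequential weak limit of admissible distributions is admissible for the limit set. -/
theorem exists_isAdmissible_iInter {α : ℝ} (hα0 : 0 < α) (hαn : α < n)
    {E : ℕ → Set (EuclideanSpace ℝ (Fin n))} (hE : ∀ j, IsCompact (E j)) (hmono : Antitone E)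
    {T : ℕ → Dist n} (hT : ∀ j, IsAdmissible α (E j) (T j)) {U : Ultrafilter ℕ}
    (hU : (U : Filter ℕ) ≤ atTop) :
    ∃ S : Dist n, IsAdmissible α (⋂ j, E j) S ∧
      ∀ φ, Tendsto (fun j => T j φ) U (𝓝 (S φ)) := by
  obtain ⟨S, hS⟩ := exists_tendsto_apply hα0 hαn (hE 0)
    (fun j => (hT j).mono (hmono (Nat.zero_le j))) U
  have hsupp := dsupport_subset_iInter hE hmono (fun j => (hT j).1) hU hS
  refine ⟨S, ⟨hsupp, fun i => ?_⟩, hS⟩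
  choose f hfm hf1 hf using fun j => (hT j).2 i
  obtain ⟨g, hgm, hg1, hg⟩ := exists_tendsto_integral_mul_test hfm hf1 U
  refine ⟨g, hgm, hg1, fun φ => ?_⟩
  -- One test function equal to the potential of `φ` near `E 0` computes the pairing for all `T j`
  -- and for `S`, so weak convergence applies to it.
  obtain ⟨ψ, hψ⟩ := exists_test_eventuallyEq (hE 0) (contDiff_reflectedPotential hα0 hαn i φ)
  rw [pairing_eq_apply (hsupp.trans (iInter_subset E 0)) hψ]
  refine tendsto_nhds_unique (hS ψ) ((hg φ).congr fun j => ?_)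
  rw [← hf j φ, pairing_eq_apply ((hT j).1.trans (hmono (Nat.zero_le j))) hψ]

theorem iInf_capacity_le {α : ℝ} (hα0 : 0 < α) (hαn : α < n)
    {E : ℕ → Set (EuclideanSpace ℝ (Fin n))} (hE : ∀ j, IsCompact (E j)) (hmono : Antitone E) :
    ⨅ j, capacity α (E j) ≤ capacity α (⋂ j, E j) := by
  refine le_of_forall_lt fun b hb => ?_
  -- The strict lower bound on the pairings becomes non-strict in the limit; the intermediate level
  -- `c` keeps the conclusion strict.
  obtain ⟨c, hbc, hc⟩ := exists_between hb
  have h : ∀ j, ∃ T : Dist n, IsAdmissible α (E j) T ∧ c < ENNReal.ofReal |pairing T 1| := by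
    intro j
    obtain ⟨T, hT⟩ := lt_iSup_iff.1 (hc.trans_le (iInf_le _ j))
    obtain ⟨hT, h⟩ := lt_iSup_iff.1 hT
    exact ⟨T, hT, h⟩
  choose T hT hTc using h
  obtain ⟨S, hSa, hS⟩ := exists_isAdmissible_iInter hα0 hαn hE hmono hT
    (Ultrafilter.of_le atTop)
  obtain ⟨χ, hχ⟩ := exists_test_eventuallyEq (hE 0) (g := 1) contDiff_const
  refine hbc.trans_le (le_iSup₂_of_le S hSa ?_)
  rw [pairing_eq_apply (hSa.1.trans (iInter_subset E 0)) hχ]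
  refine ge_of_tendsto (ENNReal.tendsto_ofReal (hS χ).abs) (univ_mem' fun j => ?_)
  rw [mem_ofPred_eq, ← pairing_eq_apply ((hT j).1.trans (hmono (Nat.zero_le j))) hχ]
  exact (hTc j).le

end RieszCapacity

end

theorem mainTheorem5 (n : ℕ) (α : ℝ) (hα0 : 0 < α) (hαn : α < n)
    (E : Set (EuclideanSpace ℝ (Fin n))) (Ej : ℕ → Set (EuclideanSpace ℝ (Fin n)))
    (hcompact : ∀ j, IsCompact (Ej j)) (hdecr : ∀ j, Ej (j + 1) ⊆ Ej j)
    (hE : E = ⋂ j, Ej j) :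
    RieszCapacity.capacity α E < ⊤ ∧
      (∀ j, RieszCapacity.capacity α (Ej j) < ⊤) ∧
      Filter.Tendsto (fun j => RieszCapacity.capacity α (Ej j)) Filter.atTop
        (nhds (RieszCapacity.capacity α E)) := by
  have hmono : Antitone Ej := antitone_nat_of_succ_le hdecr
  have hsub : ∀ j, E ⊆ Ej j := fun j => hE ▸ Set.iInter_subset Ej j
  have hfin : ∀ j, RieszCapacity.capacity α (Ej j) < ⊤ := fun j =>
    RieszCapacity.capacity_lt_top hα0 hαn (hcompact j)
  refine ⟨(RieszCapacity.capacity_mono (hsub 0)).trans_lt (hfin 0), hfin, ?_⟩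
  have heq : RieszCapacity.capacity α E = ⨅ j, RieszCapacity.capacity α (Ej j) :=
    le_antisymm (le_iInf fun j => RieszCapacity.capacity_mono (hsub j))
      (hE ▸ RieszCapacity.iInf_capacity_le hα0 hαn hcompact hmono)
  rw [heq]
  exact tendsto_atTop_iInf fun i j hij => RieszCapacity.capacity_mono (hmono hij)
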